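/- **Setting.** Let $G=(U,L,E)$ be a finite bipartite graph with disjoint layers $U,L$, vertex set $V(G)=U\cup L$ and undirected edges between $U$ and $L$. Vertices have distinct ids, and every vertex of $U$ has a larger id than every vertex of $L$. A butterfly is a $(2,2)$-biclique of $G$; the support $\bowtie_e$ of an edge $e$ in a graph is the number of butterflies of that graph containing $e$. For $k\ge 0$, a $k$-bitruss of $G$ is a maximal subgraph $H$ of $G$ such that every edge of $H$ has support at least $k$ in $H$. The bitruss number $\phi(e)$ is the largest $k$ such that a $k$-bitruss of $G$ contains $e$. Let $\tau\in(0,1]$. **Algorithm BiT-PC** (input $G,\tau$). Initially no edge is assigned. Let $k_{\max}$ be the largest $k$ such that at least $k$ edges of $G$ have support at least $k$ in $G$; put $\varepsilon=k_{\max}$. While $G$ has unassigned edges, do (1)–(4): 1. *Candidate subgraph.* Let $H$ be the subgraph of $G$ formed by the edges with support at least $\varepsilon$ in $G$. Recompute the supports on $H$ and remove the edges with support below $\varepsilon$ (in one pass, or in several consecutive passes). Initialise a variable $s_e$, for each edge $e$ of the resulting graph $H$, with the support of $e$ in $H$. 2. *Compressed BE-Index.* Order the vertices by degree in $H$, ties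 being broken by id; the rank $p(u)$ is the priority of $u$. For each $u$ and each $w\in V(H)$, count the wedges $(u,v,w)$ of $H$ (i.e. $v\in N_H(u)$, $w\in N_H(v)$) with $p(v)<p(u)$ and $p(w)<p(u)$; let $c$ be their number. If $c>1$, a bloom $B$ anchored by $(u,w)$ is recorded with $b_B=\binom c2$; for each of these wedges, those of the edges $uv,vw$ that are unassigned are inserted into the index, and, if at least one of them is unassigned, $B$ is linked with $uv$ and $vw$, which are recorded as twin edges of each other in $B$. (Assigned edges are not inserted, but they still count in the recorded numbers $b_B$.) 3. *Peeling.* While $H$ has unassigned edges: let $M$ be the minimum of $s_e$ over the unassigned edges $e$ of $H$, let $S$ be the set of unassigned edges of $H$ with $s_e=M$, and put $C(B)=0$ for all blooms $B$. - For each $e\in S$: if $s_e\ge\varepsilon$, output $\phi_e:=s_e$. For each bloom $B$ linked to $e$: increase $C(B)$ by $1$, and, if the twin edge $e'$ of $e$ in $B$ is not assigned, set $s_{e'}:=\max\{M,s_{e'}-(k-1)\}$, where $k\ge1$ and $\binom k2=b_B$, and delete the link between $B$ and $e'$. - Then, for each bloom $B$ with $C(B)>0$: with $k\ge1$, $\binom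 k2=b_B$, set $b_B:=\frac{(k-C(B))(k-1-C(B))}2$, and for each edge $e'\notin S$ of the index that is linked to $B$ set $s_{e'}:=\max\{M,s_{e'}-C(B)\}$. - Then remove the edges of $S$ from $H$ and from the index, and mark those $e\in S$ with $s_e\ge\varepsilon$ as assigned. 4. *Next threshold.* Replace $\varepsilon$ by $\max\{\varepsilon-\lceil k_{\max}\tau\rceil,0\}$. When all edges of $G$ are assigned, return the values $\phi_e$. All "for each" loops may process their elements in any order. **Theorem.** BiT-PC correctly solves bitruss decomposition: for every such $G$, ids and $\tau\in(0,1]$, every run of BiT-PC terminates (without getting stuck) and returns values with $\phi_e=\phi(e)$ for every edge $e\in E$. -/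

import Mathlib

open Finset

namespace Bitruss

/-- A finite bipartite graph with upper layer `U`, lower layer `L` and undirected edges
`s(u, v)` (so `(u, v)` and `(v, u)` denote the same edge), each joining the two layers. -/
structure BipartiteGraph (V : Type*) where
  U : Finset V
  L : Finset V
  E : Finset (Sym2 V)
  disjoint : Disjoint U L
  edge_between : ∀ e ∈ E, ∃ u ∈ U, ∃ v ∈ L, e = s(u, v)

namespace BipartiteGraph

variable {V : Type*}

/-- `H ≤ G`: `H` is a subgraph of `G`. -/
instance : LE (BipartiteGraph V) where
  le H G := H.U ⊆ G.U ∧ H.L ⊆ G.L ∧ H.E ⊆ G.E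

variable [DecidableEq V]

/-- The subgraph with the same vertices and those edges that satisfy `p`. -/
def filterEdges (G : BipartiteGraph V) (p : Sym2 V → Prop) [DecidablePred p] :
    BipartiteGraph V where
  U := G.U
  L := G.L
  E := G.E.filter p
  disjoint := G.disjoint
  edge_between := fun e he => G.edge_between e (Finset.mem_filter.mp he).1

/-- The vertex set `V(G)`. -/
def verts (G : BipartiteGraph V) : Finset V := G.U ∪ G.L

/-- The set of neighbours `N_G(u)`. -/
def nbr (G : BipartiteGraph V) (u : V) : Finset V := G.verts.filter (fun v => s(u, v) ∈ G.E)

/-- The degree `d_G(u)`. -/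
def deg (G : BipartiteGraph V) (u : V) : ℕ := (G.nbr u).card

/-- The butterflies of `G`, i.e. its `(2,2)`-bicliques `[u, v, w, x]`, each given once, as the
pair `({u, w}, {v, x})` of its two layers. -/
def butterflies (G : BipartiteGraph V) : Finset (Finset V × Finset V) :=
  (G.U.powersetCard 2 ×ˢ G.L.powersetCard 2).filter
    (fun b => ∀ u ∈ b.1, ∀ v ∈ b.2, s(u, v) ∈ G.E)

/-- The butterfly support of `e` in `G`: the number of butterflies of `G` that contain `e`. -/
def support (G : BipartiteGraph V) (e : Sym2 V) : ℕ :=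
  (G.butterflies.filter (fun b => ∃ u ∈ b.1, ∃ v ∈ b.2, e = s(u, v))).card

/-- `H` is a `k`-bitruss of `G`: a maximal subgraph of `G` every edge of which has
butterfly support at least `k` in that subgraph. -/
def IsBitruss (G : BipartiteGraph V) (k : ℕ) (H : BipartiteGraph V) : Prop :=
  Maximal (fun K : BipartiteGraph V => K ≤ G ∧ ∀ e ∈ K.E, k ≤ K.support e) H

/-- `k` is the bitruss number of `e` in `G`: the largest `k` for which a `k`-bitruss of `G`
contains `e`. (The value `0` occurs when no `k`-bitruss with `k ≥ 1` contains `e`.) -/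
def IsBitrussNumber (G : BipartiteGraph V) (e : Sym2 V) (k : ℕ) : Prop :=
  IsGreatest {j : ℕ | ∃ H : BipartiteGraph V, G.IsBitruss j H ∧ e ∈ H.E} k

/-- The priority `p(u)`, a number in `[1, |V(G)|]` for `u ∈ V(G)`: the rank of `u` when vertices
are compared by degree first and by id second. -/
def priority (G : BipartiteGraph V) (vid : V → ℕ) (u : V) : ℕ :=
  (G.verts.filter (fun x => G.deg x < G.deg u ∨ (G.deg x = G.deg u ∧ vid x ≤ vid u))).card

/-- The neighbours of `v` whose priority is smaller than that of `u`. -/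
def nbrBelow (G : BipartiteGraph V) (vid : V → ℕ) (u v : V) : Finset V :=
  (G.nbr v).filter (fun w => G.priority vid w < G.priority vid u)

/-- The edges of `G` whose butterfly support in `G` is at least `ε` are kept, all others are
removed (simultaneously, in one pass). -/
def keep (ε : ℕ) (G : BipartiteGraph V) : BipartiteGraph V :=
  G.filterEdges (fun e => ε ≤ G.support e)

/-- The largest possible bitruss number: the largest `k` such that at least `k` edges of `G`
have butterfly support at least `k`. -/
def kMax (G : BipartiteGraph V) : ℕ :=
  Nat.findGreatest (fun k => k ≤ (G.E.filter (fun e => k ≤ G.support e)).card) G.E.card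

end BipartiteGraph

/-! ### Loops -/

/-- Executing `body` for the members of a list, one after the other. -/
inductive FoldLoop {α σ : Type*} (body : α → σ → σ → Prop) : List α → σ → σ → Prop
  | nil (x : σ) : FoldLoop body [] x x
  | cons {a : α} {l : List α} {x y z : σ} :
      body a x y → FoldLoop body l y z → FoldLoop body (a :: l) x z

/-- `foreach a ∈ s do body a`, in an arbitrary order: `y` is a possible final state
of the loop when it is started in the state `x`. -/
def ForEach {α σ : Type*} (s : Finset α) (body : α → σ → σ → Prop) (x y : σ) : Prop :=
  ∃ l : List α, l.Nodup ∧ (∀ a, a ∈ l ↔ a ∈ s) ∧ FoldLoop body l x y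

/-! ### The BE-Index -/

/-- The positive solution `k` of `k.choose 2 = b`. -/
def bloomNumber (b : ℕ) : ℕ := (1 + Nat.sqrt (1 + 8 * b)) / 2

theorem bloomNumber_choose (k : ℕ) (hk : 1 ≤ k) : bloomNumber (k.choose 2) = k := by
  obtain ⟨n, rfl⟩ : ∃ n, k = n + 1 := ⟨k - 1, by omega⟩
  have h2 : (n + 1).choose 2 * 2 = (n + 1) * n := by
    rw [Nat.choose_two_right, Nat.add_sub_cancel]
    exact Nat.div_mul_cancel (by rw [mul_comm]; exact (Nat.even_mul_succ_self n).two_dvd)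
  have h : 1 + 8 * (n + 1).choose 2 = (2 * n + 1) * (2 * n + 1) := by nlinarith
  rw [bloomNumber, h, Nat.sqrt_eq]
  omega

/-- A BE-Index `I`. The id of a maximal priority-obeyed bloom is the pair `(u, w)` of the vertices
of its dominant layer (its anchors), `u` being the one of larger priority; `blooms` is `U(I)`,
`edges` is `L(I)`, `links` is `E(I)`, `bloomCount B` is the number of butterflies recorded for `B`,
and `twin B e` is the recorded twin edge of `e` in `B` (`none` if nothing has been recorded).
The support recorded for an edge is kept in `PeelState.sup`. -/
structure BEIndex (V : Type*) where
  blooms : Finset (V × V)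
  edges : Finset (Sym2 V)
  links : Finset ((V × V) × Sym2 V)
  bloomCount : V × V → ℕ
  twin : V × V → Sym2 V → Option (Sym2 V)

namespace BEIndex

variable {V : Type*}

/-- The index without any entry. -/
def empty : BEIndex V where
  blooms := ∅
  edges := ∅
  links := ∅
  bloomCount := fun _ => 0
  twin := fun _ _ => none

variable [DecidableEq V]

/-- `N_I(e)`: the blooms of the index that are linked to `e`. -/
def bloomsOf (I : BEIndex V) (e : Sym2 V) : Finset (V × V) :=
  I.blooms.filter (fun B => (B, e) ∈ I.links)

/-- `N_I(B)`: the edges of the index that are linked to `B`. -/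
def edgesOf (I : BEIndex V) (B : V × V) : Finset (Sym2 V) :=
  I.edges.filter (fun e => (B, e) ∈ I.links)

/-- If `B ∉ U(I)`: add `B`, with the number `b` of butterflies, to `U(I)`. -/
def addBloom (I : BEIndex V) (B : V × V) (b : ℕ) : BEIndex V :=
  if B ∈ I.blooms then I
  else { I with blooms := insert B I.blooms, bloomCount := Function.update I.bloomCount B b }

/-- Add `e` to `L(I)` unless it is assigned (or already there). -/
def addEdge (assigned : Finset (Sym2 V)) (I : BEIndex V) (e : Sym2 V) : BEIndex V :=
  if e ∈ assigned then I else { I with edges := insert e I.edges }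

/-- Record `e'` as the twin edge of `e` in `B`. -/
def setTwin (I : BEIndex V) (B : V × V) (e e' : Sym2 V) : BEIndex V :=
  { I with twin := Function.update I.twin B (Function.update (I.twin B) e (some e')) }

/-- Unless both `e` and `e'` are assigned: link `B` with `e` and with `e'` and record
that `e` and `e'` are twin edges of each other in `B`. -/
def addLinks (assigned : Finset (Sym2 V)) (I : BEIndex V) (B : V × V) (e e' : Sym2 V) :
    BEIndex V :=
  if e ∈ assigned ∧ e' ∈ assigned then I
  else (({ I with links := insert (B, e') (insert (B, e) I.links) } : BEIndex V).setTwin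
    B e e').setTwin B e' e

/-- The treatment of one wedge `(u, v, w)` in the construction of the index. -/
def processWedge (assigned : Finset (Sym2 V)) (countWedge : V → ℕ) (u v w : V) (I : BEIndex V) :
    BEIndex V :=
  if 1 < countWedge w then
    ((((I.addBloom (u, w) ((countWedge w).choose 2)).addEdge assigned s(u, v)).addEdge
      assigned s(v, w)).addLinks assigned (u, w) s(u, v) s(v, w))
  else I

end BEIndex

section Algorithm

variable {V : Type*} [DecidableEq V]

/-- Counting the wedges `(u, v, w)` with `p(v) < p(u)` and `p(w) < p(u)`, for each `w`;
`cw` is the outcome. -/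
def CountWedges (H : BipartiteGraph V) (vid : V → ℕ) (u : V) (cw : V → ℕ) : Prop :=
  ForEach (H.nbrBelow vid u u)
    (fun v => ForEach (H.nbrBelow vid u v)
      (fun w c c' => c' = Function.update c w (c w + 1)))
    (fun _ => 0) cw

/-- CompressedIndexConstruction: `I` is a possible outcome on the candidate graph `H`, with the
edges in `assigned` being already assigned. -/
def ConstructIndex (H : BipartiteGraph V) (vid : V → ℕ) (assigned : Finset (Sym2 V))
    (I : BEIndex V) : Prop :=
  ForEach H.verts
    (fun u I₁ I₂ => ∃ cw : V → ℕ, CountWedges H vid u cw ∧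
      ForEach (H.nbrBelow vid u u)
        (fun v => ForEach (H.nbrBelow vid u v)
          (fun w J J' => J' = J.processWedge assigned cw u v w))
        I₁ I₂)
    BEIndex.empty I

/-- The variables of the peeling process: the current graph, its index, the recorded supports of
the edges, the bitruss numbers output so far (`none` where there is none yet), and the set of
edges that are marked as assigned. -/
structure PeelState (V : Type*) where
  graph : BipartiteGraph V
  index : BEIndex V
  sup : Sym2 V → ℕ
  phi : Sym2 V → Option ℕ
  assigned : Finset (Sym2 V)

/-- For `e` in the batch and a bloom `B` linked to it: increase `C(B)`; if the twin edge `e'` of `e`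
in `B` is not assigned, lower its support by `k - 1`, but not below `mbs`, and remove the link
between `B` and `e'`; here `B` is recorded as a `k`-bloom. -/
def peelBloom (mbs : ℕ) (e : Sym2 V) (B : V × V) (x : PeelState V × (V × V → ℕ)) :
    PeelState V × (V × V → ℕ) :=
  let C' := Function.update x.2 B (x.2 B + 1)
  let k := bloomNumber (x.1.index.bloomCount B)
  match x.1.index.twin B e with
  | none => (x.1, C')
  | some e' =>
      if e' ∈ x.1.assigned then (x.1, C')
      else
        ({ x.1 with
            sup := Function.update x.1.sup e' (max mbs (x.1.sup e' - (k - 1)))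
            index := { x.1.index with links := x.1.index.links.erase (B, e') } }, C')

/-- The treatment of one edge `e` of the batch: `φ_e` is set to the recorded support of `e`,
provided this is at least `ε`; then the blooms linked to `e` are treated. -/
def PeelEdge (ε mbs : ℕ) (e : Sym2 V) (x y : PeelState V × (V × V → ℕ)) : Prop :=
  ForEach (x.1.index.bloomsOf e) (fun B z z' => z' = peelBloom mbs e B z)
    ({ x.1 with
        phi := if ε ≤ x.1.sup e then Function.update x.1.phi e (some (x.1.sup e))
          else x.1.phi }, x.2) y

/-- The treatment of one bloom `B` with `C(B) > 0`: with `B` recorded as a `k`-bloom, the number of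
its butterflies becomes `(k - C(B)) (k - 1 - C(B)) / 2`, and the support of each edge outside the
batch `S` that is linked to `B` is lowered by `C(B)`, but not below `mbs`. -/
def UpdateBloom (mbs : ℕ) (S : Finset (Sym2 V)) (C : V × V → ℕ) (B : V × V)
    (x y : PeelState V) : Prop :=
  let k := bloomNumber (x.index.bloomCount B)
  ForEach (x.index.edgesOf B \ S)
    (fun e' z z' => z' = { z with sup := Function.update z.sup e' (max mbs (z.sup e' - C B)) })
    { x with
      index := { x.index with
        bloomCount := Function.update x.index.bloomCount B
          ((k - C B) * ((k - 1) - C B) / 2) } } y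

/-- The end of a batch: the edges of `S` are removed from the graph and from the index, and those
with recorded support at least `ε` are marked as assigned. -/
def finishBatch (ε : ℕ) (S : Finset (Sym2 V)) (x : PeelState V) : PeelState V :=
  { x with
    graph := x.graph.filterEdges (fun e => e ∉ S)
    index := { x.index with edges := x.index.edges \ S }
    assigned := x.assigned ∪ S.filter (fun e => ε ≤ x.sup e) }

/-- One batch of the peeling process with threshold `ε`: all unassigned edges of the current graph
with minimum recorded support are processed together. -/
def PeelBatch (ε : ℕ) (x y : PeelState V) : Prop :=
  ∃ (mbs : ℕ) (S : Finset (Sym2 V)) (x₁ : PeelState V) (C : V × V → ℕ) (x₂ : PeelState V),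
    IsLeast (x.sup '' ((x.graph.E \ x.assigned : Finset (Sym2 V)) : Set (Sym2 V))) mbs ∧
    S = (x.graph.E \ x.assigned).filter (fun e => x.sup e = mbs) ∧
    ForEach S (PeelEdge ε mbs) (x, fun _ => 0) (x₁, C) ∧
    ForEach (x₁.index.blooms.filter (fun B => 0 < C B)) (UpdateBloom mbs S C) x₁ x₂ ∧
    y = finishBatch ε S x₂

/-- `H` is a candidate subgraph of `G` for the threshold `ε`: the subgraph of the edges with support
at least `ε` in `G` is extracted; then the supports are recomputed on that subgraph and the
edges with support below `ε` are removed, in one pass or in several consecutive passes. -/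
def IsCandidate (G : BipartiteGraph V) (ε : ℕ) (H : BipartiteGraph V) : Prop :=
  ∃ n : ℕ, 1 ≤ n ∧ H = (BipartiteGraph.keep ε)^[n] (BipartiteGraph.keep ε G)

/-- The configurations of a run of BiT-PC: at the head of the outer while loop, at the head of the
inner while loop, or after the algorithm has returned the result `phi`. -/
inductive Config (V : Type*) where
  | outer (ε : ℕ) (phi : Sym2 V → Option ℕ) (assigned : Finset (Sym2 V))
  | inner (ε : ℕ) (x : PeelState V)
  | returned (phi : Sym2 V → Option ℕ)

/-- The initial configuration: no edge is assigned, and the threshold is `kMax`. -/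
def Config.start (G : BipartiteGraph V) : Config V :=
  .outer G.kMax (fun _ => none) ∅

/-- The steps of BiT-PC on the input `(G, τ)`, where vertices have the ids `vid`. -/
inductive Step (G : BipartiteGraph V) (vid : V → ℕ) (τ : ℝ) : Config V → Config V → Prop
  /-- There are unassigned edges in `G`: build a candidate subgraph `H`, compute the
  supports of its edges, and construct its compressed index. -/
  | enter {ε : ℕ} {phi : Sym2 V → Option ℕ} {assigned : Finset (Sym2 V)}
      {H : BipartiteGraph V} {I : BEIndex V} :
      (G.E \ assigned).Nonempty → IsCandidate G ε H → ConstructIndex H vid assigned I →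
      Step G vid τ (.outer ε phi assigned) (.inner ε ⟨H, I, H.support, phi, assigned⟩)
  /-- There are unassigned edges in the current candidate subgraph: peel one batch. -/
  | peel {ε : ℕ} {x y : PeelState V} :
      (x.graph.E \ x.assigned).Nonempty → PeelBatch ε x y →
      Step G vid τ (.inner ε x) (.inner ε y)
  /-- There are none: the threshold becomes `max {ε - ⌈kMax * τ⌉, 0}`. -/
  | leave {ε : ℕ} {x : PeelState V} :
      ¬ (x.graph.E \ x.assigned).Nonempty →
      Step G vid τ (.inner ε x) (.outer (ε - ⌈(G.kMax : ℝ) * τ⌉₊) x.phi x.assigned)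
  /-- All edges of `G` are assigned: return. -/
  | finish {ε : ℕ} {phi : Sym2 V → Option ℕ} {assigned : Finset (Sym2 V)} :
      ¬ (G.E \ assigned).Nonempty →
      Step G vid τ (.outer ε phi assigned) (.returned phi)

/-- BiT-PC correctly solves bitruss decomposition on the input `(G, τ)`: no run is infinite, no run
gets stuck before it returns, and whatever a run returns contains, for every edge of
`G`, the bitruss number of that edge. -/
def BiTPCCorrect (G : BipartiteGraph V) (vid : V → ℕ) (τ : ℝ) : Prop :=
  (¬ ∃ c : ℕ → Config V, c 0 = Config.start G ∧ ∀ n, Step G vid τ (c n) (c (n + 1))) ∧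
  (∀ c : Config V, Relation.ReflTransGen (Step G vid τ) (Config.start G) c →
    (∃ c' : Config V, Step G vid τ c c') ∨ ∃ phi, c = .returned phi) ∧
  (∀ phi : Sym2 V → Option ℕ,
    Relation.ReflTransGen (Step G vid τ) (Config.start G) (.returned phi) →
      ∀ e ∈ G.E, ∃ k : ℕ, phi e = some k ∧ G.IsBitrussNumber e k)

end Algorithm

end Bitruss

/-! Subgraphs in which every edge has support at least `k` are closed under union, because support
grows with the graph. Hence there is a largest one, `truss k`; it decreases in `k`, and the bitruss
number of `e` is the last `k` with `e` in `truss k`.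

Index. A butterfly has a unique vertex `u` of top priority. With the vertex `w` opposite to it in
its layer, `u` anchors one bloom, and the other two vertices are middles of wedges of that bloom. So
an edge has, in each bloom with `k` live wedges that uses it, exactly `k - 1` butterflies
(`support_eq_sum_bloomSet`). Removing a batch `S` costs a surviving edge all `k - 1` of these where
its twin lies in `S`, and otherwise one per wedge hit by `S` (`support_eq_support_add`). The two
loops of a batch subtract exactly these two sums. Deleting links makes each wedge count once, even
if both of its edges are in `S`. Since all updates are cut off at the batch value, the recorded
support is not the true one but its maximum with the last batch value `M` (`PeelInv.sup`, preserved
by `PeelBatch.spec`).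

Peeling. On entering a round with threshold `ε`, the assigned set `A` is a whole truss `truss ε'`
with `ε ≤ ε'`, and the candidate contains `truss ε`. Two bounds are kept (`InnerInv`): each
remaining edge outside `A` lies in `truss M`, and `truss j` lies in the current graph whenever `ε ≤
j` and `M < j`. The first survives a batch because edges of `A`, though never peeled, keep support
at least `ε'` inside `truss ε'`; the second because an edge of minimum support `M` cannot lie in a
larger truss that is still present. Together they give the bitruss number of each edge that is
output (`InnerInv.peelBatch`). A finished round has assigned exactly `truss ε`, which restores the
outer invariant; at `ε = 0` this is all of `E`.

Termination. A batch is never empty, and a positive threshold strictly decreases; `Config.rank`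
combines both. -/

namespace Bitruss

/-! ### Loops with arbitrary order of execution -/

section Loops

variable {α σ : Type*} {body : α → σ → σ → Prop}

theorem ForEach.exists_of_total (hb : ∀ a x, ∃ y, body a x y) (s : Finset α) (x : σ) :
    ∃ y, ForEach s body x y := by
  have key : ∀ (l : List α) (x : σ), ∃ y, FoldLoop body l x y := by
    intro l
    induction l with
    | nil => exact fun x => ⟨x, .nil x⟩
    | cons a l ih =>
      intro x
      obtain ⟨y, hy⟩ := hb a x
      obtain ⟨z, hz⟩ := ih y
      exact ⟨z, .cons hy hz⟩
  obtain ⟨y, hy⟩ := key s.toList x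
  exact ⟨y, s.toList, s.nodup_toList, fun a => Finset.mem_toList, hy⟩

/-- Loop induction: an invariant indexed by the set of elements already processed. -/
theorem ForEach.induction [DecidableEq α] {s : Finset α} {x y : σ} (h : ForEach s body x y)
    {P : Finset α → σ → Prop} (h0 : P ∅ x)
    (hs : ∀ D a x y, D ⊆ s → a ∈ s → a ∉ D → P D x → body a x y → P (insert a D) y) :
    P s y := by
  obtain ⟨l, hnd, hl, hf⟩ := h
  have key : ∀ (l : List α) (x y : σ), FoldLoop body l x y → ∀ D : Finset α, D ⊆ s → l.Nodup →
      (∀ a ∈ l, a ∈ s ∧ a ∉ D) → P D x → P (D ∪ l.toFinset) y := by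
    intro l x y hf
    induction hf with
    | nil x => intro D _ _ _ h; simpa using h
    | @cons a l x y z hb _ ih =>
      intro D hD hnd hl hP
      have ha := hl a (by simp)
      rw [List.nodup_cons] at hnd
      have := ih (insert a D) (Finset.insert_subset ha.1 hD) hnd.2
        (fun b hb => ⟨(hl b (by simp [hb])).1, by
          simp only [Finset.mem_insert, not_or]
          exact ⟨fun h => hnd.1 (h ▸ hb), (hl b (by simp [hb])).2⟩⟩)
        (hs D a x y hD ha.1 ha.2 hP hb)
      rwa [List.toFinset_cons, Finset.union_insert, ← Finset.insert_union]
  have h1 := key l x y hf ∅ (by simp) hnd (fun a ha => ⟨(hl a).1 ha, by simp⟩) h0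
  have h2 : l.toFinset = s := by ext a; simp [hl]
  simpa [h2] using h1

/-- A loop whose body adds `f a` to the set that indexes an invariant. -/
theorem ForEach.iUnion [DecidableEq α] {β : Type*} {s : Finset α} {x y : σ}
    (h : ForEach s body x y) {Q : Set β → σ → Prop} (f : α → Set β) {T : Set β} (h0 : Q T x)
    (hs : ∀ T a x y, a ∈ s → Q T x → body a x y → Q (T ∪ f a) y) :
    Q (T ∪ ⋃ a ∈ s, f a) y := by
  refine h.induction (P := fun D z => Q (T ∪ ⋃ a ∈ D, f a) z) (by simpa using h0) ?_
  intro D a x y _ ha _ hQ hb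
  have := hs _ a x y ha hQ hb
  rw [Finset.set_biUnion_insert, Set.union_comm (f a), ← Set.union_assoc]
  exact this

end Loops

/-! ### Trusses, the bound `kMax`, and candidate subgraphs -/

namespace BipartiteGraph

variable {V : Type*}

theorem le_rfl' (G : BipartiteGraph V) : G ≤ G :=
  ⟨Finset.Subset.refl _, Finset.Subset.refl _, Finset.Subset.refl _⟩

theorem le_trans' {G H K : BipartiteGraph V} (h : G ≤ H) (h' : H ≤ K) : G ≤ K :=
  ⟨h.1.trans h'.1, h.2.1.trans h'.2.1, h.2.2.trans h'.2.2⟩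

variable [DecidableEq V]

theorem mem_butterflies {G : BipartiteGraph V} {b : Finset V × Finset V} :
    b ∈ G.butterflies ↔ ((b.1 ⊆ G.U ∧ b.1.card = 2) ∧ (b.2 ⊆ G.L ∧ b.2.card = 2)) ∧
      ∀ u ∈ b.1, ∀ v ∈ b.2, s(u, v) ∈ G.E := by
  simp [butterflies, Finset.mem_powersetCard, Finset.mem_product]

theorem butterflies_mono {K H : BipartiteGraph V} (h : K ≤ H) : K.butterflies ⊆ H.butterflies := by
  intro b hb
  rw [mem_butterflies] at hb ⊢
  exact ⟨⟨⟨hb.1.1.1.trans h.1, hb.1.1.2⟩, ⟨hb.1.2.1.trans h.2.1, hb.1.2.2⟩⟩,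
    fun u hu v hv => h.2.2 (hb.2 u hu v hv)⟩

theorem support_mono {K H : BipartiteGraph V} (h : K ≤ H) (e : Sym2 V) :
    K.support e ≤ H.support e :=
  Finset.card_le_card (Finset.filter_subset_filter _ (butterflies_mono h))

theorem exists_pair_of_mem {s : Finset V} (hs : s.card = 2) {a : V} (ha : a ∈ s) :
    ∃ b, b ≠ a ∧ s = {a, b} := by
  obtain ⟨x, y, hxy, rfl⟩ := Finset.card_eq_two.1 hs
  simp only [Finset.mem_insert, Finset.mem_singleton] at ha
  rcases ha with rfl | rfl
  · exact ⟨y, hxy.symm, rfl⟩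
  · exact ⟨x, hxy, Finset.pair_comm _ _⟩

/-- A butterfly through a fixed edge is determined by its opposite edge, so there are no more of
them than edges. This is needed for `truss_kMax_succ`. -/
theorem support_le_card (K : BipartiteGraph V) (e : Sym2 V) : K.support e ≤ K.E.card := by
  by_cases h : ∃ u ∈ K.U, ∃ v ∈ K.L, e = s(u, v)
  · obtain ⟨u, hu, v, hv, rfl⟩ := h
    -- An edge `f` is sent to the pair of layers spanned by `f` and `s(u, v)`; the butterfly on `u,
    -- w, v, x` is hit by its opposite edge `s(w, x)`.
    refine Finset.card_le_card_of_surjOn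
      (fun f => (insert u (K.U.filter (· ∈ f)), insert v (K.L.filter (· ∈ f)))) ?_
    rintro ⟨b, c⟩ hb
    simp only [Finset.coe_filter, Set.mem_ofPred_eq, mem_butterflies] at hb
    obtain ⟨⟨⟨⟨hbU, hb2⟩, hcL, hc2⟩, hE⟩, u', hu', v', hv', huv⟩ := hb
    have hne : ∀ x ∈ K.U, ∀ y ∈ K.L, x ≠ y := fun x hx y hy h =>
      Finset.disjoint_left.1 K.disjoint hx (h ▸ hy)
    have : u = u' ∧ v = v' := by
      rw [Sym2.eq_iff] at huv
      rcases huv with h | h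
      · exact h
      · exact absurd h.1 (hne u hu v' (hcL hv'))
    obtain ⟨rfl, rfl⟩ := this
    obtain ⟨w, hw, rfl⟩ := exists_pair_of_mem hb2 hu'
    obtain ⟨x, hx, rfl⟩ := exists_pair_of_mem hc2 hv'
    have hwU : w ∈ K.U := hbU (by simp)
    have hxL : x ∈ K.L := hcL (by simp)
    refine ⟨s(w, x), hE w (by simp) x (by simp), ?_⟩
    have h1 : K.U.filter (· ∈ s(w, x)) = {w} := by
      ext y
      simp only [Finset.mem_filter, Sym2.mem_iff, Finset.mem_singleton]
      constructor
      · rintro ⟨hy, rfl | rfl⟩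
        · rfl
        · exact absurd rfl (hne _ hy _ hxL)
      · rintro rfl; exact ⟨hwU, Or.inl rfl⟩
    have h2 : K.L.filter (· ∈ s(w, x)) = {x} := by
      ext y
      simp only [Finset.mem_filter, Sym2.mem_iff, Finset.mem_singleton]
      constructor
      · rintro ⟨hy, rfl | rfl⟩
        · exact absurd rfl (hne _ hwU _ hy)
        · rfl
      · rintro rfl; exact ⟨hxL, Or.inr rfl⟩
    simp only [h1, h2]
  · have : K.support e = 0 := by
      rw [support, Finset.card_eq_zero, Finset.filter_eq_empty_iff]
      rintro b hb ⟨u, hu, v, hv, rfl⟩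
      rw [mem_butterflies] at hb
      exact h ⟨u, hb.1.1.1 hu, v, hb.1.2.1 hv, rfl⟩
    omega

open Classical in
/-- The union of all subgraphs of `G` whose edges have support at least `k` inside them, on the
vertex set of `G`. -/
noncomputable def truss (G : BipartiteGraph V) (k : ℕ) : BipartiteGraph V :=
  G.filterEdges (fun e => ∃ K : BipartiteGraph V, K ≤ G ∧ (∀ f ∈ K.E, k ≤ K.support f) ∧ e ∈ K.E)

variable (G : BipartiteGraph V)

theorem truss_le (k : ℕ) : G.truss k ≤ G := by
  classical
  exact ⟨Finset.Subset.refl _, Finset.Subset.refl _, Finset.filter_subset _ _⟩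

variable {G}

theorem mem_truss {k : ℕ} {e : Sym2 V} : e ∈ (G.truss k).E ↔
    ∃ K : BipartiteGraph V, K ≤ G ∧ (∀ f ∈ K.E, k ≤ K.support f) ∧ e ∈ K.E := by
  classical
  constructor
  · intro h
    exact (Finset.mem_filter.1 h).2
  · intro h
    refine Finset.mem_filter.2 ⟨?_, h⟩
    obtain ⟨K, hK, _, he⟩ := h
    exact hK.2.2 he

theorem le_truss {k : ℕ} {K : BipartiteGraph V} (hK : K ≤ G) (h : ∀ f ∈ K.E, k ≤ K.support f) :
    K ≤ G.truss k :=
  ⟨hK.1, hK.2.1, fun _ he => mem_truss.2 ⟨K, hK, h, he⟩⟩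

theorem le_support_truss {k : ℕ} {e : Sym2 V} (he : e ∈ (G.truss k).E) :
    k ≤ (G.truss k).support e := by
  obtain ⟨K, hK, h, he⟩ := mem_truss.1 he
  exact (h e he).trans (support_mono (le_truss hK h) e)

theorem truss_antitone {j k : ℕ} (h : j ≤ k) : (G.truss k).E ⊆ (G.truss j).E := fun _ he =>
  (le_truss (truss_le G k) fun _ hf => h.trans (le_support_truss hf)).2.2 he

theorem truss_zero : (G.truss 0).E = G.E :=
  Finset.Subset.antisymm (truss_le G 0).2.2
    (le_truss (le_rfl' G) fun _ _ => Nat.zero_le _).2.2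

/-- The truss is the greatest admissible subgraph, not merely a maximal one, so membership in some
`k`-bitruss can be tested on it alone. -/
theorem isBitruss_truss (k : ℕ) : G.IsBitruss k (G.truss k) :=
  ⟨⟨truss_le G k, fun _ he => le_support_truss he⟩, fun _ hK _ => le_truss hK.1 hK.2⟩

theorem exists_isBitruss_iff {k : ℕ} {e : Sym2 V} :
    (∃ H : BipartiteGraph V, G.IsBitruss k H ∧ e ∈ H.E) ↔ e ∈ (G.truss k).E :=
  ⟨fun ⟨H, hH, he⟩ => mem_truss.2 ⟨H, hH.1.1, hH.1.2, he⟩, fun h => ⟨_, isBitruss_truss k, h⟩⟩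

theorem isBitrussNumber_of {k : ℕ} {e : Sym2 V} (h : e ∈ (G.truss k).E)
    (h' : ∀ j, k < j → e ∉ (G.truss j).E) : G.IsBitrussNumber e k := by
  refine ⟨exists_isBitruss_iff.2 h, fun j hj => ?_⟩
  by_contra! hlt
  exact h' j hlt (exists_isBitruss_iff.1 hj)

/-- One edge of `truss k` already forces `k` edges in it by `support_le_card`, and all of them have
support at least `k` in `G`; this is the condition that defines `kMax`. -/
theorem truss_kMax_succ : (G.truss (G.kMax + 1)).E = ∅ := by
  by_contra! hne
  obtain ⟨e, he⟩ := hne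
  set k := G.kMax + 1 with hk
  have h1 : k ≤ (G.truss k).E.card := (le_support_truss he).trans (support_le_card _ _)
  have h2 : (G.truss k).E ⊆ G.E.filter (fun e => k ≤ G.support e) := fun f hf =>
    Finset.mem_filter.2 ⟨(truss_le G k).2.2 hf,
      (le_support_truss hf).trans (support_mono (truss_le G k) f)⟩
  have h3 : k ≤ G.kMax := Nat.le_findGreatest
    (h1.trans (Finset.card_le_card (truss_le G k).2.2)) (h1.trans (Finset.card_le_card h2))
  omega

theorem keep_le (ε : ℕ) (H : BipartiteGraph V) : keep ε H ≤ H :=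
  ⟨Finset.Subset.refl _, Finset.Subset.refl _, Finset.filter_subset _ _⟩

theorem truss_le_keep {ε : ℕ} {H : BipartiteGraph V} (h : G.truss ε ≤ H) : G.truss ε ≤ keep ε H :=
  ⟨h.1, h.2.1, fun e he => Finset.mem_filter.2
    ⟨h.2.2 he, (le_support_truss he).trans (support_mono h e)⟩⟩

end BipartiteGraph

open BipartiteGraph

variable {V : Type*} [DecidableEq V] {G : BipartiteGraph V}

/-- A pruning pass cannot remove an edge of `truss ε`, as its support inside the truss already
suffices. The number of passes is therefore immaterial: only these inclusions are used later. -/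
theorem IsCandidate.spec {ε : ℕ} {H : BipartiteGraph V} (h : IsCandidate G ε H) :
    H ≤ G ∧ G.truss ε ≤ H ∧ H.U = G.U ∧ H.L = G.L := by
  obtain ⟨n, -, rfl⟩ := h
  induction n with
  | zero =>
    exact ⟨keep_le ε G, truss_le_keep (truss_le G ε), rfl, rfl⟩
  | succ n ih =>
    rw [Function.iterate_succ_apply']
    exact ⟨le_trans' (keep_le ε _) ih.1, truss_le_keep ih.2.1, ih.2.2.1, ih.2.2.2⟩

end Bitruss

namespace Bitruss

/-! ### Blooms, twin edges, and the decomposition of support over blooms -/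

namespace BipartiteGraph

variable {V : Type*}

theorem mem_sides_of_edge {K : BipartiteGraph V} {a b : V} (h : s(a, b) ∈ K.E) :
    (a ∈ K.U ∧ b ∈ K.L) ∨ (a ∈ K.L ∧ b ∈ K.U) := by
  obtain ⟨u, hu, v, hv, h⟩ := K.edge_between _ h
  rw [Sym2.eq_iff] at h
  rcases h with ⟨rfl, rfl⟩ | ⟨rfl, rfl⟩
  · exact Or.inl ⟨hu, hv⟩
  · exact Or.inr ⟨hv, hu⟩

variable [DecidableEq V] (H : BipartiteGraph V) (vid : V → ℕ)

/-- Distinct ids turn the comparison by degree and id into a strict total order, and the rank in it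
strictly increases. Unique top vertices of butterflies depend on this. -/
theorem priority_injOn (hvid : Set.InjOn vid (H.verts : Set V)) :
    Set.InjOn (H.priority vid) (H.verts : Set V) := by
  have key : ∀ a ∈ H.verts, ∀ b ∈ H.verts,
      (H.deg a < H.deg b ∨ (H.deg a = H.deg b ∧ vid a < vid b)) →
      H.priority vid a < H.priority vid b := by
    intro a _ b hb hab
    refine Finset.card_lt_card (Finset.ssubset_iff_of_subset ?_ |>.2 ⟨b, ?_, ?_⟩)
    · intro x
      simp only [Finset.mem_filter]
      rintro ⟨hx, h⟩
      exact ⟨hx, by omega⟩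
    · simp [hb]
    · simp only [Finset.mem_filter, not_and]
      intro _
      omega
  intro a ha b hb hab
  by_contra hne
  have hv : vid a ≠ vid b := fun h => hne (hvid ha hb h)
  rcases lt_trichotomy (H.deg a) (H.deg b) with h | h | h
  · have := key a ha b hb (Or.inl h); omega
  · rcases lt_or_gt_of_ne hv with h' | h'
    · have := key a ha b hb (Or.inr ⟨h, h'⟩); omega
    · have := key b hb a ha (Or.inr ⟨h.symm, h'⟩); omega
  · have := key b hb a ha (Or.inl h); omega

/-- The middle vertices of the wedges of the bloom anchored by `B`. -/
def wedgeMids (B : V × V) : Finset V :=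
  (H.nbrBelow vid B.1 B.1).filter (fun v => B.2 ∈ H.nbrBelow vid B.1 v)

/-- The middle vertices of those wedges of the bloom both of whose edges belong to `F`. -/
def liveMids (F : Finset (Sym2 V)) (B : V × V) : Finset V :=
  (H.wedgeMids vid B).filter (fun v => s(B.1, v) ∈ F ∧ s(v, B.2) ∈ F)

/-- The anchors of all blooms with at least two wedges. -/
def bloomSet : Finset (V × V) :=
  (H.verts ×ˢ H.verts).filter (fun B => 1 < (H.wedgeMids vid B).card)

/-- `e` and `e'` are the two edges of the wedge of `B` with middle vertex `v`. -/
def IsTwin (B : V × V) (v : V) (e e' : Sym2 V) : Prop :=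
  (e = s(B.1, v) ∧ e' = s(v, B.2)) ∨ (e = s(v, B.2) ∧ e' = s(B.1, v))

/-- `e` and `e'` are the two edges of a wedge of `B` that lies in `F`. -/
def LiveTwin (F : Finset (Sym2 V)) (B : V × V) (e e' : Sym2 V) : Prop :=
  ∃ v ∈ H.liveMids vid F B, IsTwin B v e e'

variable {H vid}

theorem mem_wedgeMids {B : V × V} {v : V} : v ∈ H.wedgeMids vid B ↔
    (v ∈ H.verts ∧ s(B.1, v) ∈ H.E ∧ H.priority vid v < H.priority vid B.1) ∧
      B.2 ∈ H.verts ∧ s(v, B.2) ∈ H.E ∧ H.priority vid B.2 < H.priority vid B.1 := by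
  simp [wedgeMids, nbrBelow, nbr, and_assoc]

theorem mem_liveMids {F : Finset (Sym2 V)} {B : V × V} {v : V} : v ∈ H.liveMids vid F B ↔
    v ∈ H.wedgeMids vid B ∧ s(B.1, v) ∈ F ∧ s(v, B.2) ∈ F := by
  simp [liveMids]

theorem mem_verts_of_edge {K : BipartiteGraph V} {a b : V} (h : s(a, b) ∈ K.E) :
    a ∈ K.verts ∧ b ∈ K.verts := by
  simp only [verts, Finset.mem_union]
  have := mem_sides_of_edge h
  tauto

theorem mem_verts_of_wedge {B : V × V} {v : V} (h : v ∈ H.wedgeMids vid B) : B.1 ∈ H.verts :=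
  (mem_verts_of_edge (mem_wedgeMids.1 h).1.2.1).1

theorem mem_bloomSet {B : V × V} : B ∈ H.bloomSet vid ↔ 1 < (H.wedgeMids vid B).card := by
  simp only [bloomSet, Finset.mem_filter, Finset.mem_product, and_iff_right_iff_imp]
  intro h
  obtain ⟨v, hv⟩ := Finset.card_pos.1 (zero_lt_one.trans h)
  exact ⟨mem_verts_of_wedge hv, (mem_wedgeMids.1 hv).2.1⟩

theorem IsTwin.symm {B : V × V} {v : V} {e e' : Sym2 V} (h : IsTwin B v e e') :
    IsTwin B v e' e := by
  unfold IsTwin at *; tauto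

theorem LiveTwin.symm {F : Finset (Sym2 V)} {B : V × V} {e e' : Sym2 V}
    (h : H.LiveTwin vid F B e e') : H.LiveTwin vid F B e' e := by
  obtain ⟨v, hv, h⟩ := h
  exact ⟨v, hv, h.symm⟩

/-- The anchor `B.1` exceeds the middles and `B.2` in priority, so it differs from all of them. An
edge of the bloom thus reveals which half of a wedge it is, and hence the middle vertex. -/
theorem IsTwin.unique {B : V × V} {v v' : V} {e f f' : Sym2 V} (hv : v ∈ H.wedgeMids vid B)
    (hv' : v' ∈ H.wedgeMids vid B) (h : IsTwin B v e f) (h' : IsTwin B v' e f') :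
    v = v' ∧ f = f' := by
  rw [mem_wedgeMids] at hv hv'
  have h1 : v ≠ B.1 := by rintro rfl; omega
  have h2 : v' ≠ B.1 := by rintro rfl; omega
  have h3 : B.2 ≠ B.1 := by intro h; rw [h] at hv; omega
  rcases h with ⟨h, g⟩ | ⟨h, g⟩ <;> rcases h' with ⟨h', g'⟩ | ⟨h', g'⟩ <;> subst g g' <;>
    rw [h, Sym2.eq_iff] at h' <;> grind

theorem LiveTwin.unique {F F' : Finset (Sym2 V)} {B : V × V} {e f f' : Sym2 V}
    (h : H.LiveTwin vid F B e f) (h' : H.LiveTwin vid F' B e f') : f = f' := by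
  obtain ⟨v, hv, h⟩ := h
  obtain ⟨v', hv', h'⟩ := h'
  exact (h.unique (mem_liveMids.1 hv).1 (mem_liveMids.1 hv').1 h').2

theorem LiveTwin.mem {F : Finset (Sym2 V)} {B : V × V} {e f : Sym2 V}
    (h : H.LiveTwin vid F B e f) : e ∈ F ∧ f ∈ F := by
  obtain ⟨v, hv, h⟩ := h
  rw [mem_liveMids] at hv
  rcases h with ⟨rfl, rfl⟩ | ⟨rfl, rfl⟩ <;> tauto

theorem LiveTwin.of_mem {F F' : Finset (Sym2 V)} {B : V × V} {e f : Sym2 V}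
    (h : H.LiveTwin vid F B e f) (he : e ∈ F') (hf : f ∈ F') : H.LiveTwin vid F' B e f := by
  obtain ⟨v, hv, h⟩ := h
  refine ⟨v, ?_, h⟩
  rw [mem_liveMids] at hv ⊢
  rcases h with ⟨rfl, rfl⟩ | ⟨rfl, rfl⟩ <;> tauto

/-- The butterfly formed by the anchors `B` and the middle vertices `v` and `x`. -/
def bloomButterfly (K : BipartiteGraph V) (B : V × V) (v x : V) : Finset V × Finset V :=
  if B.1 ∈ K.U then ({B.1, B.2}, {v, x}) else ({v, x}, {B.1, B.2})

theorem bloomButterfly_mem {K : BipartiteGraph V} {B : V × V} {v x : V}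
    (hv : v ∈ H.liveMids vid K.E B) (hx : x ∈ H.liveMids vid K.E B) (hvx : v ≠ x) :
    bloomButterfly K B v x ∈ K.butterflies := by
  rw [mem_liveMids] at hv hx
  obtain ⟨hv, hv1, hv2⟩ := hv
  obtain ⟨-, hx1, hx2⟩ := hx
  rw [mem_wedgeMids] at hv
  have h3 : B.1 ≠ B.2 := by intro h; rw [h] at hv; omega
  have hd : ∀ y ∈ K.U, y ∉ K.L := fun y h => Finset.disjoint_left.1 K.disjoint h
  have s1 := mem_sides_of_edge hv1
  have s2 := mem_sides_of_edge hv2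
  have s3 := mem_sides_of_edge hx1
  rw [mem_butterflies, bloomButterfly]
  split_ifs with hU
  · have := hd _ hU
    have hvL : v ∈ K.L := by tauto
    have hxL : x ∈ K.L := by tauto
    have hwU : B.2 ∈ K.U := by
      rcases s2 with h | h
      · exact absurd hvL (hd _ h.1)
      · exact h.2
    refine ⟨⟨⟨?_, Finset.card_pair h3⟩, ?_, Finset.card_pair hvx⟩, ?_⟩
    · simp [Finset.insert_subset_iff, hU, hwU]
    · simp [Finset.insert_subset_iff, hvL, hxL]
    · simp only [Finset.mem_insert, Finset.mem_singleton, forall_eq_or_imp, forall_eq]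
      rw [Sym2.eq_swap (a := B.2) (b := v), Sym2.eq_swap (a := B.2) (b := x)]
      tauto
  · have hvL : v ∈ K.U := by tauto
    have hxL : x ∈ K.U := by tauto
    have huL : B.1 ∈ K.L := by tauto
    have := hd _ hvL
    have hwU : B.2 ∈ K.L := by tauto
    refine ⟨⟨⟨?_, Finset.card_pair hvx⟩, ?_, Finset.card_pair h3⟩, ?_⟩
    · simp [Finset.insert_subset_iff, hvL, hxL]
    · simp [Finset.insert_subset_iff, huL, hwU]
    · simp only [Finset.mem_insert, Finset.mem_singleton, forall_eq_or_imp, forall_eq]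
      rw [Sym2.eq_swap (a := v) (b := B.1), Sym2.eq_swap (a := x) (b := B.1)]
      tauto

theorem bloomButterfly_contains (K : BipartiteGraph V) {B : V × V} {v x : V} {e f : Sym2 V}
    (h : IsTwin B v e f) : ∃ a ∈ (bloomButterfly K B v x).1, ∃ b ∈ (bloomButterfly K B v x).2,
      e = s(a, b) := by
  rw [bloomButterfly]
  rcases h with ⟨rfl, -⟩ | ⟨rfl, -⟩ <;> split_ifs
  · exact ⟨B.1, by simp, v, by simp, rfl⟩
  · exact ⟨v, by simp, B.1, by simp, Sym2.eq_swap⟩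
  · exact ⟨B.2, by simp, v, by simp, Sym2.eq_swap⟩
  · exact ⟨v, by simp, B.2, by simp, rfl⟩

theorem pair_eq_pair_iff' {a b c d : V} :
    ({a, b} : Finset V) = {c, d} ↔ (a = c ∧ b = d) ∨ (a = d ∧ b = c) := by
  rw [← Finset.coe_inj]
  push_cast
  exact Set.pair_eq_pair_iff

/-- The anchor `B.1` is recovered as the vertex of top priority among the four, `B.2` as the other
vertex of its layer; only the order of the two middles is lost. -/
theorem bloomButterfly_inj {K : BipartiteGraph V} {B B' : V × V} {v x v' x' : V}
    (hv : v ∈ H.wedgeMids vid B) (hx : x ∈ H.wedgeMids vid B)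
    (hv' : v' ∈ H.wedgeMids vid B') (hx' : x' ∈ H.wedgeMids vid B')
    (h : bloomButterfly K B v x = bloomButterfly K B' v' x') :
    B = B' ∧ ((v = v' ∧ x = x') ∨ (v = x' ∧ x = v')) := by
  have hu : ∀ {C : V × V} {a b : V}, (bloomButterfly K C a b).1 ∪ (bloomButterfly K C a b).2
      = {C.1, C.2, a, b} := by
    intro C a b
    rw [bloomButterfly]
    split_ifs <;> ext y <;> simp <;> tauto
  have hset : ({B.1, B.2, v, x} : Finset V) = {B'.1, B'.2, v', x'} := by
    rw [← hu, h, hu]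
  rw [mem_wedgeMids] at hv hx hv' hx'
  have h1 : B.1 = B'.1 := by
    have m1 : B.1 ∈ ({B'.1, B'.2, v', x'} : Finset V) := hset ▸ by simp
    have m2 : B'.1 ∈ ({B.1, B.2, v, x} : Finset V) := hset ▸ by simp
    simp only [Finset.mem_insert, Finset.mem_singleton] at m1 m2
    by_contra hne
    have l1 : H.priority vid B.1 < H.priority vid B'.1 := by
      rcases m1 with m | m | m | m
      · exact absurd m hne
      all_goals rw [m]; omega
    have l2 : H.priority vid B'.1 < H.priority vid B.1 := by
      rcases m2 with m | m | m | m
      · exact absurd m.symm hne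
      all_goals rw [m]; omega
    omega
  obtain ⟨u, w⟩ := B
  obtain ⟨u', w'⟩ := B'
  obtain rfl : u = u' := h1
  have hn : w ≠ u := by rintro rfl; simp at hv
  have hn' : w' ≠ u := by rintro rfl; simp at hv'
  simp only [bloomButterfly] at h
  split_ifs at h <;> rw [Prod.mk.injEq, pair_eq_pair_iff', pair_eq_pair_iff'] at h <;> grind

/-- Anchor the butterfly at its vertex of top priority. Priorities and blooms are those of `H`,
fixed when the index is built, while `K` is the graph left after some peeling; the butterfly then
uses wedges that are live in `K`. -/
theorem exists_bloomButterfly {K : BipartiteGraph V} (hU : K.U = H.U) (hL : K.L = H.L)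
    (hE : K.E ⊆ H.E) (hvid : Set.InjOn vid (H.verts : Set V)) {b : Finset V × Finset V}
    (hb : b ∈ K.butterflies) {e : Sym2 V} (he : ∃ a ∈ b.1, ∃ c ∈ b.2, e = s(a, c)) :
    ∃ (B : V × V) (v x : V) (f : Sym2 V), v ∈ H.liveMids vid K.E B ∧ x ∈ H.liveMids vid K.E B ∧
      v ≠ x ∧ IsTwin B v e f ∧ b = bloomButterfly K B v x := by
  obtain ⟨b1, b2⟩ := b
  obtain ⟨a, ha, c, hc, rfl⟩ := he
  obtain ⟨⟨⟨h1, c1⟩, h2, c2⟩, hbE⟩ := mem_butterflies.1 hb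
  dsimp only at *
  obtain ⟨u, hu, humax⟩ := (b1 ∪ b2).exists_max_image (H.priority vid) ⟨a, by simp [ha]⟩
  have hverts : ∀ y ∈ b1 ∪ b2, y ∈ H.verts := by
    intro y hy
    rw [verts, ← hU, ← hL]
    exact Finset.union_subset_union h1 h2 hy
  have hlt : ∀ y ∈ b1 ∪ b2, y ≠ u → H.priority vid y < H.priority vid u := fun y hy hne =>
    lt_of_le_of_ne (humax y hy) fun h =>
      hne (priority_injOn H vid hvid (hverts y hy) (hverts u hu) h)
  have hd : ∀ y ∈ b1, ∀ z ∈ b2, y ≠ z := fun y hy z hz h =>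
    Finset.disjoint_left.1 K.disjoint (h1 hy) (h ▸ h2 hz)
  rcases Finset.mem_union.1 hu with hu | hu
  · obtain ⟨w, hw, rfl⟩ := exists_pair_of_mem c1 hu
    obtain ⟨x, hx, rfl⟩ := exists_pair_of_mem c2 hc
    have hlive : ∀ y ∈ ({c, x} : Finset V), y ∈ H.liveMids vid K.E (u, w) := by
      intro y hy
      have e1 := hbE u (by simp) y hy
      have e2 := hbE w (by simp) y hy
      rw [Sym2.eq_swap] at e2
      rw [mem_liveMids, mem_wedgeMids]
      exact ⟨⟨⟨hverts y (Finset.mem_union_right _ hy), hE e1,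
        hlt y (Finset.mem_union_right _ hy) (hd u (by simp) y hy).symm⟩,
        hverts w (by simp), hE e2, hlt w (by simp) hw⟩, e1, e2⟩
    have hb' : (({u, w} : Finset V), ({c, x} : Finset V)) = bloomButterfly K (u, w) c x := by
      rw [bloomButterfly, if_pos (h1 (by simp))]
    simp only [Finset.mem_insert, Finset.mem_singleton] at ha
    rcases ha with rfl | rfl
    · exact ⟨_, c, x, _, hlive _ (by simp), hlive _ (by simp), hx.symm, Or.inl ⟨rfl, rfl⟩, hb'⟩
    · exact ⟨_, c, x, _, hlive _ (by simp), hlive _ (by simp), hx.symm,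
        Or.inr ⟨Sym2.eq_swap, rfl⟩, hb'⟩
  · obtain ⟨w, hw, rfl⟩ := exists_pair_of_mem c2 hu
    obtain ⟨x, hx, rfl⟩ := exists_pair_of_mem c1 ha
    have hlive : ∀ y ∈ ({a, x} : Finset V), y ∈ H.liveMids vid K.E (u, w) := by
      intro y hy
      have e1 := hbE y hy u (by simp)
      have e2 := hbE y hy w (by simp)
      rw [Sym2.eq_swap] at e1
      rw [mem_liveMids, mem_wedgeMids]
      exact ⟨⟨⟨hverts y (Finset.mem_union_left _ hy), hE e1,
        hlt y (Finset.mem_union_left _ hy) (hd y hy u (by simp))⟩,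
        hverts w (by simp), hE e2, hlt w (by simp) hw⟩, e1, e2⟩
    have hb' : (({a, x} : Finset V), ({u, w} : Finset V)) = bloomButterfly K (u, w) a x := by
      rw [bloomButterfly, if_neg]
      exact fun h => Finset.disjoint_left.1 K.disjoint h (h2 (by simp))
    simp only [Finset.mem_insert, Finset.mem_singleton] at hc
    rcases hc with rfl | rfl
    · exact ⟨_, a, x, _, hlive _ (by simp), hlive _ (by simp), hx.symm,
        Or.inl ⟨Sym2.eq_swap, rfl⟩, hb'⟩
    · exact ⟨_, a, x, _, hlive _ (by simp), hlive _ (by simp), hx.symm, Or.inr ⟨rfl, rfl⟩, hb'⟩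

open Classical in
/-- The support of an edge is the sum of its contributions over the blooms. -/
theorem support_eq_sum_bloomSet {K : BipartiteGraph V} (hU : K.U = H.U) (hL : K.L = H.L)
    (hE : K.E ⊆ H.E) (hvid : Set.InjOn vid (H.verts : Set V)) (e : Sym2 V) :
    K.support e = ∑ B ∈ (H.bloomSet vid).filter (fun B => ∃ f, H.LiveTwin vid K.E B e f),
      ((H.liveMids vid K.E B).card - 1) := by
  set N := (H.bloomSet vid).filter (fun B => ∃ f, H.LiveTwin vid K.E B e f) with hN
  -- The implication inside the existential lets `choose` produce total functions; their values at
  -- blooms outside `N` are arbitrary.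
  have hmid : ∀ B, ∃ v f, B ∈ N → v ∈ H.liveMids vid K.E B ∧ IsTwin B v e f := by
    intro B
    by_cases hB : B ∈ N
    · obtain ⟨f, v, hv, hf⟩ := (Finset.mem_filter.1 hB).2
      exact ⟨v, f, fun _ => ⟨hv, hf⟩⟩
    · exact ⟨B.1, e, fun h => absurd h hB⟩
  choose m g hmg using hmid
  have hm := fun B hB => (hmg B hB).1
  have hg := fun B hB => (hmg B hB).2
  have hcard : ∀ B ∈ N, ((H.liveMids vid K.E B).card - 1)
      = ((H.liveMids vid K.E B).erase (m B)).card := fun B hB => by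
    rw [Finset.card_erase_of_mem (hm B hB)]
  rw [Finset.sum_congr rfl hcard, ← Finset.card_sigma, support]
  symm
  -- A butterfly containing `e` corresponds to its bloom together with the middle vertex other than
  -- the one on the wedge of `e`.
  refine Finset.card_bij (fun (q : Σ _ : V × V, V) _ => bloomButterfly K q.1 (m q.1) q.2) ?_ ?_ ?_
  · rintro ⟨B, x⟩ h
    rw [Finset.mem_sigma] at h
    obtain ⟨hB, hx⟩ := h
    rw [Finset.mem_erase] at hx
    exact Finset.mem_filter.2 ⟨bloomButterfly_mem (hm B hB) hx.2 (Ne.symm hx.1),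
      bloomButterfly_contains K (hg B hB)⟩
  · rintro ⟨B, x⟩ h ⟨B', x'⟩ h' heq
    rw [Finset.mem_sigma] at h h'
    obtain ⟨hB, hx⟩ := h
    obtain ⟨hB', hx'⟩ := h'
    rw [Finset.mem_erase] at hx hx'
    dsimp only at *
    obtain ⟨rfl, hh⟩ := bloomButterfly_inj (mem_liveMids.1 (hm B hB)).1 (mem_liveMids.1 hx.2).1
      (mem_liveMids.1 (hm B' hB')).1 (mem_liveMids.1 hx'.2).1 heq
    rcases hh with ⟨-, rfl⟩ | ⟨h, -⟩
    · rfl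
    · exact absurd h.symm hx'.1
  · intro b hb
    rw [Finset.mem_filter] at hb
    obtain ⟨B, v, x, f, hv, hx, hvx, ht, rfl⟩ :=
      exists_bloomButterfly hU hL hE hvid hb.1 hb.2
    have hB : B ∈ N := by
      rw [hN, Finset.mem_filter, mem_bloomSet]
      exact ⟨Finset.one_lt_card.2 ⟨v, (mem_liveMids.1 hv).1, x, (mem_liveMids.1 hx).1, hvx⟩,
        f, v, hv, ht⟩
    have hmv : m B = v := ((hg B hB).unique (mem_liveMids.1 (hm B hB)).1 (mem_liveMids.1 hv).1 ht).1
    refine ⟨⟨B, x⟩, ?_, by simp only [hmv]⟩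
    rw [Finset.mem_sigma, Finset.mem_erase]
    exact ⟨hB, by simp only [hmv]; exact hvx.symm, hx⟩

end BipartiteGraph

end Bitruss

/-! ### Construction of the compressed index -/

namespace Bitruss

open BipartiteGraph

variable {V : Type*} [DecidableEq V] {H : BipartiteGraph V} {vid : V → ℕ}

theorem CountWedges.eq_card {u : V} {cw : V → ℕ} (h : CountWedges H vid u cw) (w : V) :
    cw w = (H.wedgeMids vid (u, w)).card := by
  refine h.induction (P := fun D c => ∀ w, c w =
    (D.filter (fun v => w ∈ H.nbrBelow vid u v)).card) (by simp) ?_ w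
  intro D v c c' _ _ hvD hc hb w
  have h1 := hb.induction (P := fun D' c' => ∀ w, c' w = c w + if w ∈ D' then 1 else 0)
    (by simp) (by
      rintro D' a x y - - ha hx rfl w
      by_cases hwa : w = a
      · subst hwa; simp [hx, ha]
      · simp [hwa, hx]) w
  rw [h1, hc, Finset.filter_insert]
  split_ifs
  · rw [Finset.card_insert_of_notMem (fun h => hvD (Finset.mem_filter.1 h).1)]
  · rfl

/-- The entries of the index `I` after the wedges in `T`, given as pairs of a bloom and a middle
vertex, have been treated. -/
structure IndexSpec (H : BipartiteGraph V) (vid : V → ℕ) (A : Finset (Sym2 V))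
    (T : Set ((V × V) × V)) (I : BEIndex V) : Prop where
  sub : ∀ B v, (B, v) ∈ T → v ∈ H.wedgeMids vid B
  mem_blooms : ∀ B ∈ H.bloomSet vid, ∀ v, (B, v) ∈ T → B ∈ I.blooms
  blooms_sub : I.blooms ⊆ H.bloomSet vid
  count : ∀ B ∈ I.blooms, I.bloomCount B = (H.wedgeMids vid B).card.choose 2
  links : ∀ B e, (B, e) ∈ I.links ↔
    B ∈ H.bloomSet vid ∧ ∃ v f, (B, v) ∈ T ∧ IsTwin B v e f ∧ ¬(e ∈ A ∧ f ∈ A)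
  twin : ∀ B ∈ H.bloomSet vid, ∀ v e f, (B, v) ∈ T → IsTwin B v e f → ¬(e ∈ A ∧ f ∈ A) →
    I.twin B e = some f
  edges : ∀ B ∈ H.bloomSet vid, ∀ v e f, (B, v) ∈ T → IsTwin B v e f → e ∉ A → e ∈ I.edges

namespace BEIndex

variable (A : Finset (Sym2 V)) (cw : V → ℕ) (u v w : V) (I : BEIndex V)

theorem addLinks_links (B B' : V × V) (e f e' : Sym2 V) : (B', e') ∈ (I.addLinks A B e f).links ↔
    (B', e') ∈ I.links ∨ (¬(e ∈ A ∧ f ∈ A) ∧ B' = B ∧ (e' = e ∨ e' = f)) := by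
  unfold addLinks
  split_ifs with h
  · tauto
  · simp only [setTwin, Finset.mem_insert, Prod.mk.injEq]
    tauto

theorem addLinks_twin (B B' : V × V) (e f e' : Sym2 V) : (I.addLinks A B e f).twin B' e' =
    if ¬(e ∈ A ∧ f ∈ A) ∧ B' = B ∧ e' = f then some e
    else if ¬(e ∈ A ∧ f ∈ A) ∧ B' = B ∧ e' = e then some f else I.twin B' e' := by
  unfold addLinks
  by_cases h : e ∈ A ∧ f ∈ A
  · simp [h]
  · rw [if_neg h]
    by_cases hB : B' = B
    · subst hB
      simp [setTwin, h, Function.update_apply]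
    · simp [setTwin, hB]

theorem addEdge_edges (e e' : Sym2 V) :
    e' ∈ (I.addEdge A e).edges ↔ e' ∈ I.edges ∨ (e ∉ A ∧ e' = e) := by
  unfold addEdge
  split_ifs with h
  · tauto
  · simp only [Finset.mem_insert]; tauto

theorem addLinks_rest (B : V × V) (e f : Sym2 V) : (I.addLinks A B e f).edges = I.edges ∧
    (I.addLinks A B e f).blooms = I.blooms ∧
    (I.addLinks A B e f).bloomCount = I.bloomCount := by
  unfold addLinks; split_ifs <;> exact ⟨rfl, rfl, rfl⟩

theorem addEdge_rest (e : Sym2 V) : (I.addEdge A e).links = I.links ∧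
    (I.addEdge A e).blooms = I.blooms ∧ (I.addEdge A e).bloomCount = I.bloomCount ∧
    (I.addEdge A e).twin = I.twin := by
  unfold addEdge; split_ifs <;> exact ⟨rfl, rfl, rfl, rfl⟩

theorem addBloom_rest (B : V × V) (b : ℕ) : (I.addBloom B b).links = I.links ∧
    (I.addBloom B b).edges = I.edges ∧ (I.addBloom B b).twin = I.twin ∧
    (I.addBloom B b).blooms = insert B I.blooms ∧ ∀ B', (I.addBloom B b).bloomCount B' =
      if B' = B ∧ B ∉ I.blooms then b else I.bloomCount B' := by
  unfold addBloom
  split_ifs with h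
  · exact ⟨rfl, rfl, rfl, (Finset.insert_eq_of_mem h).symm, by simp [h]⟩
  · exact ⟨rfl, rfl, rfl, rfl, fun B' => by simp [h, Function.update_apply]⟩

end BEIndex

open BEIndex in
-- Entries of different wedges of one bloom never conflict, since an edge has only one twin there;
-- hence the order in which wedges are treated does not matter.
theorem IndexSpec.processWedge {A : Finset (Sym2 V)} {T : Set ((V × V) × V)} {I : BEIndex V}
    (h : IndexSpec H vid A T I) {cw : V → ℕ} {u v w : V} (hv : v ∈ H.wedgeMids vid (u, w))
    (hcw : cw w = (H.wedgeMids vid (u, w)).card) :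
    IndexSpec H vid A (T ∪ {((u, w), v)}) (I.processWedge A cw u v w) := by
  have hsub : ∀ B x, (B, x) ∈ T ∪ {((u, w), v)} → x ∈ H.wedgeMids vid B := by
    rintro B x (hx | hx)
    · exact h.sub B x hx
    · obtain ⟨rfl, rfl⟩ := Prod.mk.inj hx; exact hv
  have hTw : ∀ {B : V × V} {x : V} {e f : Sym2 V}, (B, x) ∈ T ∪ {((u, w), v)} → IsTwin B x e f →
      ((B, x) ∈ T ∧ IsTwin B x e f) ∨ (B = (u, w) ∧ x = v ∧ ((e = s(u, v) ∧ f = s(v, w)) ∨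
        (e = s(v, w) ∧ f = s(u, v)))) := by
    rintro B x e f (hx | hx) ht
    · exact Or.inl ⟨hx, ht⟩
    · obtain ⟨rfl, rfl⟩ := Prod.mk.inj hx
      exact Or.inr ⟨rfl, rfl, ht⟩
  unfold BEIndex.processWedge
  split_ifs with hc
  · have hB : (u, w) ∈ H.bloomSet vid := by rw [mem_bloomSet, ← hcw]; exact hc
    set I1 := I.addBloom (u, w) ((cw w).choose 2) with hI1
    set I2 := I1.addEdge A s(u, v) with hI2
    set I3 := I2.addEdge A s(v, w) with hI3
    obtain ⟨a1, a2, a3, a4, a5⟩ := addBloom_rest I (u, w) ((cw w).choose 2)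
    obtain ⟨b1, b2, b3, b4⟩ := addEdge_rest A I1 s(u, v)
    obtain ⟨c1, c2, c3, c4⟩ := addEdge_rest A I2 s(v, w)
    obtain ⟨d1, d2, d3⟩ := addLinks_rest A I3 (u, w) s(u, v) s(v, w)
    rw [← hI1] at a1 a2 a3 a4 a5
    rw [← hI2] at b1 b2 b3 b4
    rw [← hI3] at c1 c2 c3 c4
    have hbl : (I3.addLinks A (u, w) s(u, v) s(v, w)).blooms = insert (u, w) I.blooms := by
      rw [d2, c2, b2, a4]
    refine ⟨hsub, ?_, ?_, ?_, ?_, ?_, ?_⟩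
    · rintro B hB x (hx | hx)
      · rw [hbl]; exact Finset.mem_insert_of_mem (h.mem_blooms B hB x hx)
      · obtain ⟨rfl, rfl⟩ := Prod.mk.inj hx; rw [hbl]; exact Finset.mem_insert_self _ _
    · rw [hbl]; exact Finset.insert_subset hB h.blooms_sub
    · intro B hBm
      rw [hbl] at hBm
      rw [d3, c3, b3, a5]
      split_ifs with hcond
      · rw [hcond.1, hcw]
      · rcases Finset.mem_insert.1 hBm with rfl | hBm
        · exact h.count _ (by tauto)
        · exact h.count B hBm
    · intro B e
      rw [addLinks_links, c1, b1, a1, h.links]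
      constructor
      · rintro (⟨hB, x, f, hx, ht, hA⟩ | ⟨hA, rfl, rfl | rfl⟩)
        · exact ⟨hB, x, f, Or.inl hx, ht, hA⟩
        · exact ⟨hB, v, s(v, w), Or.inr rfl, Or.inl ⟨rfl, rfl⟩, hA⟩
        · exact ⟨hB, v, s(u, v), Or.inr rfl, Or.inr ⟨rfl, rfl⟩, by tauto⟩
      · rintro ⟨hB, x, f, hx, ht, hA⟩
        rcases hTw hx ht with hh | ⟨rfl, rfl, ⟨rfl, rfl⟩ | ⟨rfl, rfl⟩⟩
        · exact Or.inl ⟨hB, x, f, hh.1, ht, hA⟩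
        · exact Or.inr ⟨hA, rfl, Or.inl rfl⟩
        · exact Or.inr ⟨by tauto, rfl, Or.inr rfl⟩
    · intro B hB' x e f hx ht hA
      -- If the record written now concerns an edge already recorded in this bloom, uniqueness of
      -- twins shows that the overwritten value is the same.
      have huniq : ∀ {e' f' : Sym2 V}, IsTwin (u, w) v e' f' → B = (u, w) → e = e' → f = f' := by
        rintro e' f' h' rfl rfl
        exact (ht.unique (hsub _ x hx) hv h').2
      have hA' : B = (u, w) → e = s(u, v) → ¬(s(u, v) ∈ A ∧ s(v, w) ∈ A) := fun h1 h2 => by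
        rw [← h2, ← huniq (Or.inl ⟨rfl, rfl⟩) h1 h2]; exact hA
      have hA'' : B = (u, w) → e = s(v, w) → ¬(s(u, v) ∈ A ∧ s(v, w) ∈ A) := fun h1 h2 => by
        rw [← h2, ← huniq (Or.inr ⟨rfl, rfl⟩) h1 h2]; tauto
      rw [addLinks_twin]
      split_ifs with k1 k2
      · rw [huniq (Or.inr ⟨rfl, rfl⟩) k1.2.1 k1.2.2]
      · rw [huniq (Or.inl ⟨rfl, rfl⟩) k2.2.1 k2.2.2]
      · rw [c4, b4, a3]
        rcases hTw hx ht with hh | ⟨rfl, rfl, ⟨rfl, rfl⟩ | ⟨rfl, rfl⟩⟩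
        · exact h.twin B hB' x e f hh.1 ht hA
        · exact absurd ⟨hA' rfl rfl, rfl, rfl⟩ k2
        · exact absurd ⟨hA'' rfl rfl, rfl, rfl⟩ k1
    · intro B hB' x e f hx ht hA
      rw [d1, addEdge_edges, addEdge_edges, a2]
      rcases hTw hx ht with hh | ⟨rfl, rfl, ⟨rfl, rfl⟩ | ⟨rfl, rfl⟩⟩
      · exact Or.inl (Or.inl (h.edges B hB' x e f hh.1 ht hA))
      · exact Or.inl (Or.inr ⟨hA, rfl⟩)
      · exact Or.inr ⟨hA, rfl⟩
  -- With at most one wedge the pair anchors no bloom of the index, and the specification ignores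
  -- the new wedge apart from its membership in `T`.
  · have hB : (u, w) ∉ H.bloomSet vid := by rw [mem_bloomSet, ← hcw]; exact hc
    have hT : ∀ B ∈ H.bloomSet vid, ∀ x, (B, x) ∈ T ∪ {((u, w), v)} → (B, x) ∈ T := by
      rintro B hB' x (hx | hx)
      · exact hx
      · obtain ⟨rfl, rfl⟩ := Prod.mk.inj hx; exact absurd hB' hB
    refine ⟨hsub, fun B hB x hx => h.mem_blooms B hB x (hT B hB x hx), h.blooms_sub, h.count, ?_,
      fun B hB x e f hx => h.twin B hB x e f (hT B hB x hx),
      fun B hB x e f hx => h.edges B hB x e f (hT B hB x hx)⟩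
    intro B e
    rw [h.links]
    constructor
    · rintro ⟨hB, x, f, hx, ht⟩
      exact ⟨hB, x, f, Or.inl hx, ht⟩
    · rintro ⟨hB, x, f, hx, ht⟩
      exact ⟨hB, x, f, hT B hB x hx, ht⟩

/-- The triple loop visits exactly the wedges whose top priority is at the starting vertex, so the
set indexing the invariant grows to all pairs of a bloom and a middle vertex. -/
theorem ConstructIndex.spec {A : Finset (Sym2 V)} {I : BEIndex V}
    (h : ConstructIndex H vid A I) : IndexSpec H vid A {q | q.2 ∈ H.wedgeMids vid q.1} I := by
  have h0 : IndexSpec H vid A ∅ (BEIndex.empty : BEIndex V) := by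
    constructor <;> simp [BEIndex.empty]
  have := h.iUnion (Q := IndexSpec H vid A) (f := fun u =>
      ⋃ v ∈ H.nbrBelow vid u u, ⋃ w ∈ H.nbrBelow vid u v, {((u, w), v)}) h0 (by
    rintro T u I₁ I₂ - hT ⟨cw, hcw, hI⟩
    refine hI.iUnion (Q := IndexSpec H vid A)
      (f := fun v => ⋃ w ∈ H.nbrBelow vid u v, {((u, w), v)}) hT ?_
    intro T v J J' hv hT hJ
    refine hJ.iUnion (Q := IndexSpec H vid A) (f := fun w => {((u, w), v)}) hT ?_
    rintro T w K K' hw hT rfl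
    exact hT.processWedge (Finset.mem_filter.2 ⟨hv, hw⟩) (hcw.eq_card w))
  convert this using 1
  ext ⟨⟨u, w⟩, v⟩
  simp only [Set.mem_ofPred_eq, Set.empty_union, Set.mem_iUnion, Set.mem_singleton_iff,
    Prod.mk.injEq, exists_prop]
  constructor
  · intro hv
    exact ⟨u, mem_verts_of_wedge hv, v, (Finset.mem_filter.1 hv).1, w, (Finset.mem_filter.1 hv).2,
      ⟨rfl, rfl⟩, rfl⟩
  · rintro ⟨u, hu, v, hv, w, hw, ⟨rfl, rfl⟩, rfl⟩
    exact Finset.mem_filter.2 ⟨hv, hw⟩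

end Bitruss

/-! ### One batch of the peeling process -/

namespace Bitruss

open BipartiteGraph

variable {V : Type*} [DecidableEq V] {H : BipartiteGraph V} {vid : V → ℕ}

namespace BipartiteGraph

/-- The middle vertices of the wedges of `B` in `F` that have an edge in `D`. -/
def touchedMids (H : BipartiteGraph V) (vid : V → ℕ) (F D : Finset (Sym2 V)) (B : V × V) :
    Finset V :=
  (H.liveMids vid F B).filter (fun v => s(B.1, v) ∈ D ∨ s(v, B.2) ∈ D)

theorem card_liveMids_sdiff (F D : Finset (Sym2 V)) (B : V × V) :
    (H.liveMids vid (F \ D) B).card + (H.touchedMids vid F D B).card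
      = (H.liveMids vid F B).card := by
  have : H.liveMids vid (F \ D) B =
      (H.liveMids vid F B).filter (fun v => ¬(s(B.1, v) ∈ D ∨ s(v, B.2) ∈ D)) := by
    ext v
    simp only [mem_liveMids, Finset.mem_filter, Finset.mem_sdiff]
    tauto
  rw [this, touchedMids, add_comm, Finset.card_filter_add_card_filter_not]

theorem LiveTwin.sdiff_iff {F D : Finset (Sym2 V)} {B : V × V} {e f : Sym2 V} (he : e ∉ D) :
    H.LiveTwin vid (F \ D) B e f ↔ H.LiveTwin vid F B e f ∧ f ∉ D := by
  constructor
  · intro h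
    have := h.mem
    simp only [Finset.mem_sdiff] at this
    exact ⟨h.of_mem this.1.1 this.2.1, this.2.2⟩
  · rintro ⟨h, hf⟩
    exact h.of_mem (Finset.mem_sdiff.2 ⟨h.mem.1, he⟩) (Finset.mem_sdiff.2 ⟨h.mem.2, hf⟩)

/-- A new edge hits a new wedge precisely when its twin has not been treated before. With the
complementary lemma below, this is why `C(B)` counts wedges rather than edges of the batch. -/
theorem card_touchedMids_insert_of_live {F D : Finset (Sym2 V)} {B : V × V} {e f : Sym2 V}
    (h : H.LiveTwin vid F B e f) (he : e ∉ D) (hf : f ∉ D) :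
    (H.touchedMids vid F (insert e D) B).card = (H.touchedMids vid F D B).card + 1 := by
  obtain ⟨v, hv, ht⟩ := h
  have hv' : v ∉ H.touchedMids vid F D B := by
    rw [touchedMids, Finset.mem_filter]
    rcases ht with ⟨rfl, rfl⟩ | ⟨rfl, rfl⟩ <;> tauto
  rw [← Finset.card_insert_of_notMem hv']
  congr 1
  ext x
  simp only [touchedMids, Finset.mem_insert, Finset.mem_filter]
  constructor
  · rintro ⟨hx, hx'⟩
    have key : ∀ g, IsTwin B x e g → x = v := fun g hg =>
      (hg.unique (mem_liveMids.1 hx).1 (mem_liveMids.1 hv).1 ht).1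
    rcases hx' with (h | h) | (h | h)
    · exact Or.inl (key _ (Or.inl ⟨h.symm, rfl⟩))
    · exact Or.inr ⟨hx, Or.inl h⟩
    · exact Or.inl (key _ (Or.inr ⟨h.symm, rfl⟩))
    · exact Or.inr ⟨hx, Or.inr h⟩
  · rintro (rfl | ⟨hx, hx'⟩)
    · refine ⟨hv, ?_⟩
      rcases ht with ⟨rfl, rfl⟩ | ⟨rfl, rfl⟩ <;> tauto
    · exact ⟨hx, by tauto⟩

theorem card_touchedMids_insert_of_not_live {F D : Finset (Sym2 V)} {B : V × V} {e : Sym2 V}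
    (h : ∀ f, H.LiveTwin vid F B e f → f ∈ D) :
    (H.touchedMids vid F (insert e D) B).card = (H.touchedMids vid F D B).card := by
  congr 1
  ext x
  simp only [touchedMids, Finset.mem_insert, Finset.mem_filter, and_congr_right_iff]
  intro hx
  have h1 : s(B.1, x) = e → s(x, B.2) ∈ D := fun he => h _ ⟨x, hx, Or.inl ⟨he.symm, rfl⟩⟩
  have h2 : s(x, B.2) = e → s(B.1, x) ∈ D := fun he => h _ ⟨x, hx, Or.inr ⟨he.symm, rfl⟩⟩
  tauto

theorem LiveTwin.card_pos {F : Finset (Sym2 V)} {B : V × V} {e f : Sym2 V}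
    (h : H.LiveTwin vid F B e f) : 1 ≤ (H.liveMids vid F B).card := by
  obtain ⟨v, hv, -⟩ := h
  exact Finset.card_pos.2 ⟨v, hv⟩

open Classical in
/-- The number of butterflies that contain `f` and the twin of `f`, if this twin is in `D`. -/
noncomputable def twinLoss (H : BipartiteGraph V) (vid : V → ℕ) (F D : Finset (Sym2 V))
    (f : Sym2 V) : ℕ :=
  ∑ B ∈ (H.bloomSet vid).filter (fun B => ∃ e ∈ D, H.LiveTwin vid F B f e),
    ((H.liveMids vid F B).card - 1)

open Classical in
/-- The number of butterflies of `f` that are lost in blooms where the twin of `f` is not in `D`,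
when `D` is removed. -/
noncomputable def bloomLoss (H : BipartiteGraph V) (vid : V → ℕ) (F D : Finset (Sym2 V))
    (f : Sym2 V) : ℕ :=
  ∑ B ∈ (H.bloomSet vid).filter (fun B => ∃ e, H.LiveTwin vid F B f e ∧ e ∉ D),
    (H.touchedMids vid F D B).card

/-- Compare bloom by bloom. With `k` live wedges of which `t` are hit, the contribution `k - 1` of
`f` disappears entirely if its twin is in `S`; otherwise the wedge of `f` survives and the
contribution becomes `k - t - 1`. -/
theorem support_eq_support_add {K K' : BipartiteGraph V} (hU : K.U = H.U) (hL : K.L = H.L)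
    (hE : K.E ⊆ H.E) (hU' : K'.U = H.U) (hL' : K'.L = H.L) {S : Finset (Sym2 V)}
    (hE' : K'.E = K.E \ S) (hvid : Set.InjOn vid (H.verts : Set V)) {f : Sym2 V} (hf : f ∉ S) :
    K.support f = K'.support f + H.twinLoss vid K.E S f + H.bloomLoss vid K.E S f := by
  classical
  have hE'' : K'.E ⊆ H.E := by rw [hE']; exact Finset.sdiff_subset.trans hE
  rw [support_eq_sum_bloomSet hU hL hE hvid, support_eq_sum_bloomSet hU' hL' hE'' hvid,
    twinLoss, bloomLoss]
  simp only [Finset.sum_filter]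
  rw [← Finset.sum_add_distrib, ← Finset.sum_add_distrib]
  refine Finset.sum_congr rfl fun B _ => ?_
  simp only [hE', LiveTwin.sdiff_iff hf]
  have hc := card_liveMids_sdiff (H := H) (vid := vid) K.E S B
  by_cases h : ∃ g, H.LiveTwin vid K.E B f g
  · obtain ⟨g, hg⟩ := h
    by_cases hgS : g ∈ S
    · have h1 : ¬ ∃ e, H.LiveTwin vid K.E B f e ∧ e ∉ S := by
        rintro ⟨e, he, heS⟩
        exact heS (he.unique hg ▸ hgS)
      rw [if_pos ⟨g, hg⟩, if_neg h1, if_pos ⟨g, hgS, hg⟩, if_neg h1]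
      omega
    · have h1 : ¬ ∃ e ∈ S, H.LiveTwin vid K.E B f e := by
        rintro ⟨e, heS, he⟩
        exact hgS (he.unique hg ▸ heS)
      have h2 := ((LiveTwin.sdiff_iff hf).2 ⟨hg, hgS⟩).card_pos
      rw [if_pos ⟨g, hg⟩, if_pos ⟨g, hg, hgS⟩, if_neg h1, if_pos ⟨g, hg, hgS⟩]
      omega
  · have h1 : ¬ ∃ e, H.LiveTwin vid K.E B f e ∧ e ∉ S := fun ⟨e, he, _⟩ => h ⟨e, he⟩
    have h2 : ¬ ∃ e ∈ S, H.LiveTwin vid K.E B f e := fun ⟨e, _, he⟩ => h ⟨e, he⟩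
    rw [if_neg h, if_neg h1, if_neg h2]
    simp [if_neg h1]

end BipartiteGraph

/-- The invariant of the peeling process on the candidate graph `H`, where the edges in `A` were
assigned before and `M` is the support of the last batch. -/
structure PeelInv (H : BipartiteGraph V) (vid : V → ℕ) (A : Finset (Sym2 V)) (M : ℕ)
    (x : PeelState V) : Prop where
  U_eq : x.graph.U = H.U
  L_eq : x.graph.L = H.L
  E_sub : x.graph.E ⊆ H.E
  sub_assigned : A ⊆ x.assigned
  sub_graph : A ⊆ x.graph.E
  assigned_inter : ∀ e ∈ x.graph.E, e ∈ x.assigned → e ∈ A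
  blooms : x.index.blooms = H.bloomSet vid
  count : ∀ B ∈ H.bloomSet vid,
    x.index.bloomCount B = (H.liveMids vid x.graph.E B).card.choose 2
  -- Links of removed edges, and of assigned edges whose twins have been peeled, stay behind in the
  -- index; so the equivalence is claimed only for unassigned edges still present.
  links : ∀ B e, e ∈ x.graph.E → e ∉ A →
    ((B, e) ∈ x.index.links ↔ B ∈ H.bloomSet vid ∧ ∃ f, H.LiveTwin vid x.graph.E B e f)
  twin : ∀ B ∈ H.bloomSet vid, ∀ e f, H.LiveTwin vid x.graph.E B e f → ¬(e ∈ A ∧ f ∈ A) →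
    x.index.twin B e = some f
  edges : ∀ B ∈ H.bloomSet vid, ∀ e f, H.LiveTwin vid x.graph.E B e f → e ∉ A →
    e ∈ x.index.edges
  sup : ∀ e ∈ x.graph.E, e ∉ A → x.sup e = max M (x.graph.support e)

theorem IndexSpec.peelInv {A : Finset (Sym2 V)} {I : BEIndex V}
    (h : IndexSpec H vid A {q | q.2 ∈ H.wedgeMids vid q.1} I) (hA : A ⊆ H.E)
    (phi : Sym2 V → Option ℕ) : PeelInv H vid A 0 ⟨H, I, H.support, phi, A⟩ := by
  have hlive : ∀ B, H.liveMids vid H.E B = H.wedgeMids vid B := by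
    intro B
    ext v
    rw [mem_liveMids]
    exact ⟨fun h => h.1, fun h => ⟨h, (mem_wedgeMids.1 h).1.2.1, (mem_wedgeMids.1 h).2.2.1⟩⟩
  have hb : ∀ B ∈ H.bloomSet vid, B ∈ I.blooms := by
    intro B hB
    obtain ⟨v, hv⟩ := Finset.card_pos.1 (zero_lt_one.trans (mem_bloomSet.1 hB))
    exact h.mem_blooms B hB v hv
  refine ⟨rfl, rfl, Finset.Subset.refl _, Finset.Subset.refl _, hA, fun e _ he => he,
    Finset.Subset.antisymm h.blooms_sub hb, fun B hB => ?_, fun B e _ he => ?_, ?_, ?_,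
    fun e _ _ => by simp⟩
  · rw [hlive]; exact h.count B (hb B hB)
  · rw [h.links]
    simp only [LiveTwin, hlive]
    constructor
    · rintro ⟨hB, v, f, hv, ht, -⟩
      exact ⟨hB, f, v, hv, ht⟩
    · rintro ⟨hB, f, v, hv, ht⟩
      exact ⟨hB, v, f, hv, ht, fun h => he h.1⟩
  · rintro B hB e f ⟨v, hv, ht⟩ hA
    rw [hlive] at hv
    exact h.twin B hB v e f hv ht hA
  · rintro B hB e f ⟨v, hv, ht⟩ he
    rw [hlive] at hv
    exact h.edges B hB v e f hv ht he

/-- The variables that the first loop of a batch does not change. -/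
structure SameFrame (x z : PeelState V) : Prop where
  graph : z.graph = x.graph
  assigned : z.assigned = x.assigned
  blooms : z.index.blooms = x.index.blooms
  edges : z.index.edges = x.index.edges
  bloomCount : z.index.bloomCount = x.index.bloomCount
  twin : z.index.twin = x.index.twin

theorem SameFrame.trans {W : Type*} {x y z : PeelState W} (h : SameFrame x y) (h' : SameFrame y z) :
    SameFrame x z :=
  ⟨h'.1.trans h.1, h'.2.trans h.2, h'.3.trans h.3, h'.4.trans h.4, h'.5.trans h.5,
    h'.6.trans h.6⟩

theorem peelBloom_snd (M : ℕ) (e : Sym2 V) (B : V × V) (z : PeelState V × (V × V → ℕ)) :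
    (peelBloom M e B z).2 = Function.update z.2 B (z.2 B + 1) := by
  unfold peelBloom
  dsimp only
  split
  · rfl
  · split_ifs <;> rfl

theorem peelBloom_frame (M : ℕ) (e : Sym2 V) (B : V × V) (z : PeelState V × (V × V → ℕ)) :
    SameFrame z.1 (peelBloom M e B z).1 ∧ (peelBloom M e B z).1.phi = z.1.phi := by
  unfold peelBloom
  dsimp only
  split
  · exact ⟨⟨rfl, rfl, rfl, rfl, rfl, rfl⟩, rfl⟩
  · split_ifs <;> exact ⟨⟨rfl, rfl, rfl, rfl, rfl, rfl⟩, rfl⟩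

theorem peelBloom_links {M : ℕ} {e f : Sym2 V} {B : V × V} {z : PeelState V × (V × V → ℕ)}
    (hf : z.1.index.twin B e = some f) (q : (V × V) × Sym2 V) :
    q ∈ (peelBloom M e B z).1.index.links ↔
      q ∈ z.1.index.links ∧ ¬(q = (B, f) ∧ f ∉ z.1.assigned) := by
  unfold peelBloom
  dsimp only
  rw [hf]
  dsimp only
  split_ifs with h
  · simp [h]
  · simp [h, and_comm]

theorem peelBloom_sup {M : ℕ} {e f : Sym2 V} {B : V × V} {z : PeelState V × (V × V → ℕ)}
    (hf : z.1.index.twin B e = some f) (g : Sym2 V) :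
    (peelBloom M e B z).1.sup g = if g = f ∧ f ∉ z.1.assigned then
      max M (z.1.sup g - (bloomNumber (z.1.index.bloomCount B) - 1)) else z.1.sup g := by
  unfold peelBloom
  dsimp only
  rw [hf]
  dsimp only
  split_ifs with h h' h'
  · exact absurd h h'.2
  · rfl
  · simp [h'.1]
  · have : g ≠ f := fun hg => h' ⟨hg, h⟩
    simp [this]

open Classical in
/-- The effect of the treatment of one edge of a batch. -/
theorem PeelEdge.spec {A : Finset (Sym2 V)} {ε M₀ M : ℕ} {x : PeelState V}
    (hx : PeelInv H vid A M₀ x) {e : Sym2 V} (heA : e ∉ A)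
    {z y : PeelState V × (V × V → ℕ)} (hz : SameFrame x z.1)
    (hlive : ∀ B ∈ z.1.index.bloomsOf e, ∃ f, H.LiveTwin vid x.graph.E B e f)
    (hM : ∀ f ∈ x.graph.E, f ∉ A → M ≤ z.1.sup f)
    (h : PeelEdge ε M e z y) :
    SameFrame x y.1 ∧
    y.1.phi = (if ε ≤ z.1.sup e then Function.update z.1.phi e (some (z.1.sup e))
      else z.1.phi) ∧
    (∀ B, y.2 B = z.2 B + if B ∈ z.1.index.bloomsOf e then 1 else 0) ∧
    (∀ B g, g ∈ x.graph.E → g ∉ A → ((B, g) ∈ y.1.index.links ↔ (B, g) ∈ z.1.index.links ∧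
      ¬(B ∈ z.1.index.bloomsOf e ∧ H.LiveTwin vid x.graph.E B e g))) ∧
    (∀ g ∈ x.graph.E, g ∉ A → y.1.sup g = max M (z.1.sup g -
      ∑ B ∈ (z.1.index.bloomsOf e).filter (fun B => H.LiveTwin vid x.graph.E B e g),
        ((H.liveMids vid x.graph.E B).card - 1))) := by
  unfold PeelEdge at h
  refine h.induction (P := fun D y =>
    SameFrame x y.1 ∧
    y.1.phi = (if ε ≤ z.1.sup e then Function.update z.1.phi e (some (z.1.sup e))
      else z.1.phi) ∧
    (∀ B, y.2 B = z.2 B + if B ∈ D then 1 else 0) ∧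
    (∀ B g, g ∈ x.graph.E → g ∉ A → ((B, g) ∈ y.1.index.links ↔ (B, g) ∈ z.1.index.links ∧
      ¬(B ∈ D ∧ H.LiveTwin vid x.graph.E B e g))) ∧
    (∀ g ∈ x.graph.E, g ∉ A → y.1.sup g = max M (z.1.sup g -
      ∑ B ∈ D.filter (fun B => H.LiveTwin vid x.graph.E B e g),
        ((H.liveMids vid x.graph.E B).card - 1)))) ?_ ?_
  · refine ⟨⟨hz.1, hz.2, hz.3, hz.4, hz.5, hz.6⟩, rfl, by simp, by simp, fun g hg hgA => ?_⟩
    have := hM g hg hgA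
    simp [this]
  · rintro D B y y' - hB hBD ⟨h1, h2, h3, h4, h5⟩ rfl
    obtain ⟨f, hf⟩ := hlive B hB
    have hBs : B ∈ H.bloomSet vid := by
      rw [← hx.blooms, ← hz.blooms]
      exact (Finset.mem_filter.1 hB).1
    have htw : y.1.index.twin B e = some f := by
      rw [h1.twin]
      exact hx.twin B hBs e f hf (fun h => heA h.1)
    -- Bloom counts do not change during the first loop, so the `k` that is read off is the number
    -- of live wedges before the batch.
    have hnum : bloomNumber (y.1.index.bloomCount B) = (H.liveMids vid x.graph.E B).card := by
      rw [h1.bloomCount, hx.count B hBs, bloomNumber_choose _ hf.card_pos]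
    have hfA : ∀ g ∈ x.graph.E, g ∉ A → g ∉ y.1.assigned := fun g hg hgA h => by
      rw [h1.assigned] at h
      exact hgA (hx.assigned_inter g hg h)
    obtain ⟨p1, p2⟩ := peelBloom_frame M e B y
    refine ⟨h1.trans p1, p2.trans h2, ?_, ?_, ?_⟩
    · intro B'
      rw [peelBloom_snd]
      by_cases hBB : B' = B
      · subst hBB
        simp [h3, hBD]
      · simp [hBB, h3]
    · intro B' g hg hgA
      rw [peelBloom_links htw, h4 B' g hg hgA, Finset.mem_insert]
      have key : ((B', g) = (B, f) ∧ f ∉ y.1.assigned) ↔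
          B' = B ∧ H.LiveTwin vid x.graph.E B' e g := by
        constructor
        · rintro ⟨hq, -⟩
          obtain ⟨rfl, rfl⟩ := Prod.mk.inj hq
          exact ⟨rfl, hf⟩
        · rintro ⟨rfl, ht⟩
          obtain rfl := ht.unique hf
          exact ⟨rfl, hfA g hg hgA⟩
      rw [key]
      tauto
    · intro g hg hgA
      rw [peelBloom_sup htw, hnum, h5 g hg hgA, Finset.filter_insert]
      by_cases hgf : g = f
      · subst hgf
        -- Successive subtractions cut off at `M` amount to one subtraction of the sum, cut off at
        -- `M`.
        rw [if_pos ⟨rfl, hfA g hg hgA⟩, if_pos hf, Finset.sum_insert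
          (fun h => hBD (Finset.mem_filter.1 h).1)]
        omega
      · have : ¬ H.LiveTwin vid x.graph.E B e g := fun h => hgf (h.unique hf)
        rw [if_neg (fun h => hgf h.1), if_neg this]

/-- The state of the first loop of a batch `S`, started in `x`, after the edges in `D` have been
treated. -/
structure BatchInv (H : BipartiteGraph V) (vid : V → ℕ) (A : Finset (Sym2 V)) (ε M : ℕ)
    (S : Finset (Sym2 V)) (x : PeelState V) (D : Finset (Sym2 V))
    (z : PeelState V × (V × V → ℕ)) : Prop where
  frame : SameFrame x z.1
  phi : ∀ f, z.1.phi f = if f ∈ D ∧ ε ≤ M then some M else x.phi f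
  counter : ∀ B ∈ H.bloomSet vid, z.2 B = (H.touchedMids vid x.graph.E D B).card
  links : ∀ B e, e ∈ x.graph.E → e ∉ A → e ∉ D → ((B, e) ∈ z.1.index.links ↔
    B ∈ H.bloomSet vid ∧ ∃ f, H.LiveTwin vid x.graph.E B e f ∧ f ∉ D)
  sup_batch : ∀ e ∈ S, z.1.sup e = M
  sup : ∀ f ∈ x.graph.E, f ∉ A → f ∉ S →
    z.1.sup f = max M (x.sup f - H.twinLoss vid x.graph.E D f)

theorem BatchInv.peelEdge {A : Finset (Sym2 V)} {ε M₀ M : ℕ} {x : PeelState V}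
    (hx : PeelInv H vid A M₀ x) {S D : Finset (Sym2 V)} (hS : S ⊆ x.graph.E \ A)
    {e : Sym2 V} (hDS : D ⊆ S) (he : e ∈ S) (heD : e ∉ D) {z y : PeelState V × (V × V → ℕ)}
    (hz : BatchInv H vid A ε M S x D z) (h : PeelEdge ε M e z y) :
    BatchInv H vid A ε M S x (insert e D) y := by
  classical
  obtain ⟨heE, heA⟩ := Finset.mem_sdiff.1 (hS he)
  -- Because of the earlier link deletions, `e` is now linked only to blooms where its twin is still
  -- untreated. A wedge with both edges in the batch is thus met once.
  have hN : ∀ B, B ∈ z.1.index.bloomsOf e ↔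
      B ∈ H.bloomSet vid ∧ ∃ f, H.LiveTwin vid x.graph.E B e f ∧ f ∉ D := by
    intro B
    rw [BEIndex.bloomsOf, Finset.mem_filter, hz.links B e heE heA heD, hz.frame.blooms, hx.blooms]
    tauto
  have hM : ∀ f ∈ x.graph.E, f ∉ A → M ≤ z.1.sup f := by
    intro f hf hfA
    by_cases hfS : f ∈ S
    · rw [hz.sup_batch f hfS]
    · rw [hz.sup f hf hfA hfS]; exact le_max_left _ _
  obtain ⟨k1, k2, k3, k4, k5⟩ := h.spec hx heA hz.frame
    (fun B hB => by obtain ⟨-, f, hf, -⟩ := (hN B).1 hB; exact ⟨f, hf⟩) hM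
  refine ⟨k1, ?_, ?_, ?_, ?_, ?_⟩
  · intro f
    rw [k2, hz.sup_batch e he]
    by_cases hfe : f = e
    · subst hfe
      by_cases hε : ε ≤ M
      · simp [hε]
      · simp [hε, hz.phi]
    · by_cases hε : ε ≤ M
      · simp [hε, hz.phi, hfe]
      · simp [hε, hz.phi]
  · intro B hB
    rw [k3, hz.counter B hB]
    by_cases hBN : B ∈ z.1.index.bloomsOf e
    · obtain ⟨-, f, hf, hfD⟩ := (hN B).1 hBN
      rw [if_pos hBN, card_touchedMids_insert_of_live hf heD hfD]
    · rw [if_neg hBN, card_touchedMids_insert_of_not_live, add_zero]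
      intro f hf
      by_contra hfD
      exact hBN ((hN B).2 ⟨hB, f, hf, hfD⟩)
  · intro B g hg hgA hgD
    rw [Finset.mem_insert, not_or] at hgD
    rw [k4 B g hg hgA, hz.links B g hg hgA hgD.2, hN]
    constructor
    · rintro ⟨⟨hB, f, hf, hfD⟩, hn⟩
      refine ⟨hB, f, hf, ?_⟩
      rw [Finset.mem_insert, not_or]
      refine ⟨?_, hfD⟩
      rintro rfl
      exact hn ⟨⟨hB, g, hf.symm, hgD.2⟩, hf.symm⟩
    · rintro ⟨hB, f, hf, hfD⟩
      rw [Finset.mem_insert, not_or] at hfD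
      refine ⟨⟨hB, f, hf, hfD.2⟩, ?_⟩
      rintro ⟨-, ht⟩
      exact hfD.1 (hf.unique ht.symm)
  · intro f hf
    obtain ⟨hfE, hfA⟩ := Finset.mem_sdiff.1 (hS hf)
    -- Edges of the batch already sit at the cut-off value `M`, so losing butterflies to other
    -- members of the batch does not move them.
    rw [k5 f hfE hfA, hz.sup_batch f hf]
    omega
  · intro f hfE hfA hfS
    have hfD : f ∉ D := fun h => hfS (hDS h)
    rw [k5 f hfE hfA, hz.sup f hfE hfA hfS]
    -- Treating `e` affects `f` in the blooms where `e` is the twin of `f`; these are disjoint from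
    -- those accounted for by `D`, as twins are unique.
    have hsum : H.twinLoss vid x.graph.E (insert e D) f = H.twinLoss vid x.graph.E D f +
        ∑ B ∈ (z.1.index.bloomsOf e).filter (fun B => H.LiveTwin vid x.graph.E B e f),
          ((H.liveMids vid x.graph.E B).card - 1) := by
      rw [twinLoss, twinLoss, ← Finset.sum_union]
      · congr 1
        ext B
        simp only [Finset.mem_union, Finset.mem_filter, Finset.mem_insert, hN,
          exists_eq_or_imp]
        constructor
        · rintro ⟨hB, ht | hD⟩
          · exact Or.inr ⟨⟨hB, f, ht.symm, hfD⟩, ht.symm⟩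
          · exact Or.inl ⟨hB, hD⟩
        · rintro (⟨hB, hD⟩ | ⟨⟨hB, -⟩, ht⟩)
          · exact ⟨hB, Or.inr hD⟩
          · exact ⟨hB, Or.inl ht.symm⟩
      · rw [Finset.disjoint_left]
        intro B hB hB'
        obtain ⟨g, hg, ht⟩ := (Finset.mem_filter.1 hB).2
        obtain rfl := ht.unique (Finset.mem_filter.1 hB').2.symm
        exact heD hg
    rw [hsum]
    omega

theorem UpdateBloom.spec {M : ℕ} {S : Finset (Sym2 V)} {C : V × V → ℕ} {B : V × V}
    {x y : PeelState V} (h : UpdateBloom M S C B x y) :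
    y = { x with
      index := { x.index with
        bloomCount := Function.update x.index.bloomCount B
          ((bloomNumber (x.index.bloomCount B) - C B) *
            ((bloomNumber (x.index.bloomCount B) - 1) - C B) / 2) }
      sup := fun f => if f ∈ x.index.edgesOf B \ S then max M (x.sup f - C B) else x.sup f } := by
  unfold UpdateBloom at h
  refine h.induction (P := fun D y => y = { x with
      index := { x.index with
        bloomCount := Function.update x.index.bloomCount B
          ((bloomNumber (x.index.bloomCount B) - C B) *
            ((bloomNumber (x.index.bloomCount B) - 1) - C B) / 2) }
      sup := fun f => if f ∈ D then max M (x.sup f - C B) else x.sup f }) (by simp) ?_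
  rintro D e z z' - - heD rfl rfl
  congr 1
  funext f
  by_cases hf : f = e
  · subst hf; simp [heD]
  · simp [hf]

/-- The effect of the second loop of a batch. -/
theorem ForEach.updateBloom_spec {M : ℕ} {S : Finset (Sym2 V)} {C : V × V → ℕ}
    {x y : PeelState V} {N : Finset (V × V)} (h : ForEach N (UpdateBloom M S C) x y) :
    (y.graph = x.graph ∧ y.phi = x.phi ∧ y.assigned = x.assigned) ∧
    (y.index.blooms = x.index.blooms ∧ y.index.edges = x.index.edges ∧
      y.index.links = x.index.links ∧ y.index.twin = x.index.twin) ∧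
    (∀ B, y.index.bloomCount B = if B ∈ N then
      (bloomNumber (x.index.bloomCount B) - C B) *
        ((bloomNumber (x.index.bloomCount B) - 1) - C B) / 2 else x.index.bloomCount B) ∧
    (∀ f ∈ S, y.sup f = x.sup f) ∧
    (∀ f ∉ S, M ≤ x.sup f → y.sup f =
      max M (x.sup f - ∑ B ∈ N.filter (fun B => f ∈ x.index.edgesOf B), C B)) := by
  refine h.induction (P := fun D y =>
    (y.graph = x.graph ∧ y.phi = x.phi ∧ y.assigned = x.assigned) ∧
    (y.index.blooms = x.index.blooms ∧ y.index.edges = x.index.edges ∧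
      y.index.links = x.index.links ∧ y.index.twin = x.index.twin) ∧
    (∀ B, y.index.bloomCount B = if B ∈ D then
      (bloomNumber (x.index.bloomCount B) - C B) *
        ((bloomNumber (x.index.bloomCount B) - 1) - C B) / 2 else x.index.bloomCount B) ∧
    (∀ f ∈ S, y.sup f = x.sup f) ∧
    (∀ f ∉ S, M ≤ x.sup f → y.sup f =
      max M (x.sup f - ∑ B ∈ D.filter (fun B => f ∈ x.index.edgesOf B), C B))) ?_ ?_
  · refine ⟨⟨rfl, rfl, rfl⟩, ⟨rfl, rfl, rfl, rfl⟩, by simp, by simp, ?_⟩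
    intro f _ hf
    simp [hf]
  · rintro D B z z' - - hBD ⟨⟨h1, h2, h3⟩, ⟨h4, h5, h6, h7⟩, h8, h9, h10⟩ hb
    have hed : ∀ B', z.index.edgesOf B' = x.index.edgesOf B' := by
      intro B'
      rw [BEIndex.edgesOf, BEIndex.edgesOf, h5, h6]
    rw [hb.spec]
    refine ⟨⟨h1, h2, h3⟩, ⟨h4, h5, h6, h7⟩, ?_, ?_, ?_⟩
    · intro B'
      by_cases hBB : B' = B
      · subst hBB
        simp [h8, hBD]
      · simp [hBB, h8]
    · intro f hf
      simp [hf, h9 f hf]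
    · intro f hf hfM
      dsimp only
      rw [hed, h10 f hf hfM, Finset.filter_insert]
      by_cases hfB : f ∈ x.index.edgesOf B
      · rw [if_pos (Finset.mem_sdiff.2 ⟨hfB, hf⟩), if_pos hfB, Finset.sum_insert
          (fun h => hBD (Finset.mem_filter.1 h).1)]
        omega
      · rw [if_neg (fun h => hfB (Finset.mem_sdiff.1 h).1), if_neg hfB]

/-- One batch preserves the invariant, and removes the edges of minimum recorded support. -/
theorem PeelBatch.spec {A : Finset (Sym2 V)} {ε M₀ : ℕ} {x y : PeelState V}
    (hvid : Set.InjOn vid (H.verts : Set V)) (hx : PeelInv H vid A M₀ x)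
    (h : PeelBatch ε x y) :
    ∃ (M : ℕ) (S : Finset (Sym2 V)), M₀ ≤ M ∧ S.Nonempty ∧ S ⊆ x.graph.E \ A ∧
      (∀ e ∈ S, x.sup e = M) ∧ (∀ e ∈ x.graph.E \ A, M ≤ x.sup e) ∧ PeelInv H vid A M y ∧
      y.graph.E = x.graph.E \ S ∧ y.assigned = (x.assigned ∪ if ε ≤ M then S else ∅) ∧
      ∀ f, y.phi f = if f ∈ S ∧ ε ≤ M then some M else x.phi f := by
  obtain ⟨M, S, x₁, C, x₂, hleast, hSdef, h1, h2, rfl⟩ := h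
  -- Edges assigned during this round have left the graph, so the assigned edges still present are
  -- exactly those of `A`.
  have hdiff : x.graph.E \ x.assigned = x.graph.E \ A := by
    ext e
    simp only [Finset.mem_sdiff, and_congr_right_iff]
    intro he
    exact not_congr ⟨hx.assigned_inter e he, fun h => hx.sub_assigned h⟩
  rw [hdiff] at hleast hSdef
  obtain ⟨⟨e₀, he₀, he₀M⟩, hmin⟩ := hleast
  have hS : S ⊆ x.graph.E \ A := hSdef ▸ Finset.filter_subset _ _
  have hSM : ∀ e ∈ S, x.sup e = M := fun e he => by
    rw [hSdef] at he; exact (Finset.mem_filter.1 he).2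
  have hMle : ∀ e ∈ x.graph.E \ A, M ≤ x.sup e := fun e he => hmin ⟨e, he, rfl⟩
  have hM₀ : M₀ ≤ M := by
    obtain ⟨a, b⟩ := Finset.mem_sdiff.1 (Finset.mem_coe.1 he₀)
    rw [← he₀M, hx.sup e₀ a b]
    exact le_max_left _ _
  have hb : BatchInv H vid A ε M S x S (x₁, C) := by
    refine h1.induction (P := BatchInv H vid A ε M S x) ?_
      (fun D e z z' hD he heD hz h => hz.peelEdge hx hS hD he heD h)
    refine ⟨⟨rfl, rfl, rfl, rfl, rfl, rfl⟩, by simp, by simp [touchedMids], ?_, hSM, ?_⟩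
    · intro B e he heA _
      simpa using hx.links B e he heA
    · intro f hf hfA _
      have := hMle f (Finset.mem_sdiff.2 ⟨hf, hfA⟩)
      simp [twinLoss, this]
  have hframe := hb.frame
  obtain ⟨⟨g1, g2, g3⟩, ⟨g4, g5, g6, g7⟩, g8, g9, g10⟩ := h2.updateBloom_spec
  have hsupS : ∀ e ∈ S, x₂.sup e = M := fun e he => (g9 e he).trans (hb.sup_batch e he)
  have hfil : S.filter (fun e => ε ≤ x₂.sup e) = if ε ≤ M then S else ∅ := by
    split_ifs with hε
    · exact Finset.filter_true_of_mem fun e he => by rw [hsupS e he]; exact hε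
    · exact Finset.filter_false_of_mem fun e he => by rw [hsupS e he]; exact hε
  have hE : (finishBatch ε S x₂).graph.E = x.graph.E \ S := by
    have hg : x₂.graph = x.graph := g1.trans hframe.graph
    ext e
    simp [finishBatch, filterEdges, hg]
  have hassigned : (finishBatch ε S x₂).assigned = x.assigned ∪ if ε ≤ M then S else ∅ := by
    rw [← hfil, ← hframe.assigned, ← g3]
    rfl
  have hed : ∀ f ∈ x.graph.E, f ∉ A → f ∉ S → ∀ B, f ∈ x₁.index.edgesOf B ↔
      B ∈ H.bloomSet vid ∧ ∃ g, H.LiveTwin vid x.graph.E B f g ∧ g ∉ S := by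
    intro f hf hfA hfS B
    rw [BEIndex.edgesOf, Finset.mem_filter, hb.links B f hf hfA hfS, hframe.edges,
      and_iff_right_iff_imp]
    rintro ⟨hB, g, hg, -⟩
    exact hx.edges B hB f g hg hfA
  refine ⟨M, S, hM₀, ⟨e₀, ?_⟩, hS, hSM, hMle, ?_, hE, hassigned, ?_⟩
  · rw [hSdef]
    exact Finset.mem_filter.2 ⟨he₀, he₀M⟩
  · have hU' : (finishBatch ε S x₂).graph.U = H.U := by
      rw [← hx.U_eq, ← hframe.graph, ← g1]; rfl
    have hL' : (finishBatch ε S x₂).graph.L = H.L := by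
      rw [← hx.L_eq, ← hframe.graph, ← g1]; rfl
    refine ⟨hU', hL', ?_, ?_, ?_, ?_, ?_, ?_, ?_, ?_, ?_, ?_⟩
    · rw [hE]
      exact Finset.sdiff_subset.trans hx.E_sub
    · rw [hassigned]
      exact hx.sub_assigned.trans Finset.subset_union_left
    · intro e he
      rw [hE, Finset.mem_sdiff]
      exact ⟨hx.sub_graph he, fun h => (Finset.mem_sdiff.1 (hS h)).2 he⟩
    · intro e he he'
      rw [hE, Finset.mem_sdiff] at he
      rw [hassigned, Finset.mem_union] at he'
      rcases he' with he' | he'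
      · exact hx.assigned_inter e he.1 he'
      · split_ifs at he'
        · exact absurd he' he.2
        · exact absurd he' (Finset.notMem_empty _)
    · rw [← hx.blooms, ← hframe.blooms, ← g4]; rfl
    · intro B hB
      have hbc : (finishBatch ε S x₂).index.bloomCount B = x₂.index.bloomCount B := rfl
      have hc := card_liveMids_sdiff (H := H) (vid := vid) x.graph.E S B
      have hC := hb.counter B hB
      dsimp only at hC
      have hBN : B ∈ x₁.index.blooms.filter (fun B => 0 < C B) ↔ 0 < C B := by
        rw [Finset.mem_filter, hframe.blooms, hx.blooms]
        exact and_iff_right hB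
      rw [hbc, hE, g8, hframe.bloomCount, hx.count B hB]
      by_cases hpos : 0 < C B
      -- The new count is `(k - t).choose 2`, where `t = C B` wedges are hit and `k - t` remain.
      · rw [if_pos (hBN.2 hpos), bloomNumber_choose _ (by omega), Nat.choose_two_right, ← hc, hC]
        congr 2 <;> omega
      · rw [if_neg (fun h => hpos (hBN.1 h))]
        congr 1
        omega
    · intro B e he heA
      rw [hE] at he ⊢
      obtain ⟨he, heS⟩ := Finset.mem_sdiff.1 he
      have hl : (finishBatch ε S x₂).index.links = x₁.index.links := g6
      rw [hl, hb.links B e he heA heS]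
      simp only [LiveTwin.sdiff_iff heS]
    · intro B hB e f ht
      rw [hE] at ht
      have htw : (finishBatch ε S x₂).index.twin = x.index.twin := g7.trans hframe.twin
      rw [htw]
      exact hx.twin B hB e f (ht.of_mem (Finset.mem_sdiff.1 ht.mem.1).1
        (Finset.mem_sdiff.1 ht.mem.2).1)
    · intro B hB e f ht heA
      rw [hE] at ht
      have hed' : (finishBatch ε S x₂).index.edges = x.index.edges \ S := by
        rw [← hframe.edges, ← g5]; rfl
      obtain ⟨he, heS⟩ := Finset.mem_sdiff.1 ht.mem.1
      rw [hed', Finset.mem_sdiff]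
      exact ⟨hx.edges B hB e f (ht.of_mem he (Finset.mem_sdiff.1 ht.mem.2).1) heA, heS⟩
    · intro f hf hfA
      rw [hE] at hf
      obtain ⟨hf, hfS⟩ := Finset.mem_sdiff.1 hf
      have hs1 := hb.sup f hf hfA hfS
      dsimp only at hs1
      have hs2 := g10 f hfS (by rw [hs1]; exact le_max_left _ _)
      have hs3 : (finishBatch ε S x₂).sup f = x₂.sup f := rfl
      -- After the first loop `f` is linked exactly to the blooms where its twin survives, so the
      -- updates sum to `bloomLoss`; the skipped blooms have `C B = 0`.
      have hloss : ∑ B ∈ (x₁.index.blooms.filter (fun B => 0 < C B)).filter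
          (fun B => f ∈ x₁.index.edgesOf B), C B = H.bloomLoss vid x.graph.E S f := by
        classical
        rw [bloomLoss, ← Finset.sum_congr rfl
          (fun B hB => hb.counter B (Finset.mem_filter.1 hB).1)]
        refine Finset.sum_subset ?_ ?_
        · intro B hB
          obtain ⟨-, hB⟩ := Finset.mem_filter.1 hB
          exact Finset.mem_filter.2 ((hed f hf hfA hfS B).1 hB)
        · intro B hB hB'
          have hB'' := Finset.mem_filter.1 hB
          by_contra hne
          refine hB' (Finset.mem_filter.2 ⟨Finset.mem_filter.2 ⟨?_, Nat.pos_of_ne_zero hne⟩,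
            (hed f hf hfA hfS B).2 hB''⟩)
          rw [hframe.blooms, hx.blooms]
          exact hB''.1
      -- The old value is `max M₀ (x.graph.support f)` with `M₀ ≤ M`. Subtracting both losses with
      -- cut-off `M` leaves the maximum of `M` and the new support.
      have hsplit := support_eq_support_add hx.U_eq hx.L_eq hx.E_sub hU' hL' hE hvid hfS
      have h0 := hx.sup f hf hfA
      rw [hs3, hs2, hloss, hs1, h0]
      omega
  · intro f
    have hphi : (finishBatch ε S x₂).phi = x₁.phi := g2
    rw [hphi]
    exact hb.phi f

theorem PeelBatch.exists {ε : ℕ} {x : PeelState V} (h : (x.graph.E \ x.assigned).Nonempty) :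
    ∃ y, PeelBatch ε x y := by
  obtain ⟨e, he, hmin⟩ := Finset.exists_min_image _ x.sup h
  obtain ⟨⟨x₁, C⟩, h1⟩ := ForEach.exists_of_total (body := PeelEdge ε (x.sup e))
    (fun f z => ForEach.exists_of_total
      (body := fun B z z' => z' = peelBloom (x.sup e) f B z) (fun B z => ⟨_, rfl⟩) _ _)
    ((x.graph.E \ x.assigned).filter (fun f => x.sup f = x.sup e)) (x, fun _ => 0)
  obtain ⟨x₂, h2⟩ := ForEach.exists_of_total (body := UpdateBloom (x.sup e)
    ((x.graph.E \ x.assigned).filter (fun f => x.sup f = x.sup e)) C)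
    (fun B z => ForEach.exists_of_total
      (body := fun f (z z' : PeelState V) => z' =
        { z with sup := Function.update z.sup f (max (x.sup e) (z.sup f - C B)) })
      (fun f z => ⟨_, rfl⟩) _ _)
    (x₁.index.blooms.filter (fun B => 0 < C B)) x₁
  refine ⟨_, x.sup e, _, x₁, C, x₂, ⟨⟨e, he, rfl⟩, ?_⟩, rfl, h1, h2, rfl⟩
  rintro _ ⟨f, hf, rfl⟩
  exact hmin f hf

end Bitruss

/-! ### Invariants of a whole run, and termination -/

namespace Bitruss

open BipartiteGraph

variable {V : Type*} [DecidableEq V]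

theorem ConstructIndex.exists (H : BipartiteGraph V) (vid : V → ℕ) (A : Finset (Sym2 V)) :
    ∃ I, ConstructIndex H vid A I := by
  refine ForEach.exists_of_total (fun u I => ?_) _ _
  obtain ⟨cw, hcw⟩ : ∃ cw, CountWedges H vid u cw :=
    ForEach.exists_of_total (fun v c => ForEach.exists_of_total
      (body := fun w (c c' : V → ℕ) => c' = Function.update c w (c w + 1))
      (fun w c => ⟨_, rfl⟩) _ _) _ _
  obtain ⟨J, hJ⟩ := ForEach.exists_of_total (body := fun v => ForEach (H.nbrBelow vid u v)
    (fun w J J' => J' = BEIndex.processWedge A cw u v w J))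
    (fun v J => ForEach.exists_of_total
      (body := fun w (J J' : BEIndex V) => J' = BEIndex.processWedge A cw u v w J)
      (fun w J => ⟨_, rfl⟩) _ _) (H.nbrBelow vid u u) I
  exact ⟨J, cw, hcw, hJ⟩

variable (G : BipartiteGraph V) (vid : V → ℕ) (τ : ℝ)

/-- The value that `phi` holds for `e` is the bitruss number of `e` in `G`. -/
def IsCorrectAt (phi : Sym2 V → Option ℕ) (e : Sym2 V) : Prop :=
  ∃ k, phi e = some k ∧ G.IsBitrussNumber e k

/-- The invariant at the head of the outer loop: for some threshold not below `ε`, the assigned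
edges are the edges of that bitruss, and they have got their bitruss numbers. -/
def OuterInv (ε : ℕ) (phi : Sym2 V → Option ℕ) (A : Finset (Sym2 V)) : Prop :=
  ε ≤ G.kMax ∧ (∃ ε', ε ≤ ε' ∧ A = (G.truss ε').E) ∧ ∀ e ∈ A, IsCorrectAt G phi e

/-- The invariant at the head of the inner loop, where `A` is the set of edges that were assigned
when this loop was entered and `M` is the support of the last batch. -/
structure InnerInv (ε : ℕ) (H : BipartiteGraph V) (A : Finset (Sym2 V)) (M : ℕ)
    (x : PeelState V) : Prop where
  le_kMax : ε ≤ G.kMax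
  le_G : H ≤ G
  U_eq : H.U = G.U
  L_eq : H.L = G.L
  peel : PeelInv H vid A M x
  old : ∃ ε', ε ≤ ε' ∧ A = (G.truss ε').E
  correct : ∀ e ∈ x.assigned, e ∈ (G.truss ε).E ∧ IsCorrectAt G x.phi e
  lower : ∀ e ∈ x.graph.E, e ∉ A → e ∈ (G.truss M).E
  upper : ∀ j, ε ≤ j → M < j → (G.truss j).E ⊆ x.graph.E
  cover : (G.truss ε).E ⊆ x.graph.E ∪ x.assigned

variable {G vid τ}

theorem OuterInv.start : OuterInv G G.kMax (fun _ => none) ∅ :=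
  -- Initially nothing is assigned, and the empty set is the edge set of the truss just above
  -- `kMax`.
  ⟨le_rfl, ⟨G.kMax + 1, Nat.le_succ _, truss_kMax_succ.symm⟩, by simp⟩

/-- The round starts with `M = 0`: the lower bound is trivial since `truss 0` has all edges of `G`,
and the upper bound holds since the candidate contains `truss ε`. -/
theorem OuterInv.enter {ε : ℕ}
    {phi : Sym2 V → Option ℕ} {A : Finset (Sym2 V)} (h : OuterInv G ε phi A)
    {H : BipartiteGraph V} {I : BEIndex V} (hH : IsCandidate G ε H)
    (hI : ConstructIndex H vid A I) : InnerInv G vid ε H A 0 ⟨H, I, H.support, phi, A⟩ := by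
  obtain ⟨h1, ⟨ε', hε, hA⟩, h3⟩ := h
  obtain ⟨c1, c2, c3, c4⟩ := hH.spec
  have hAε : A ⊆ (G.truss ε).E := hA ▸ truss_antitone hε
  exact ⟨h1, c1, c3, c4, hI.spec.peelInv (hAε.trans c2.2.2) phi, ⟨ε', hε, hA⟩,
    fun e he => ⟨hAε he, h3 e he⟩, fun e he _ => (truss_zero (G := G)).symm ▸ c1.2.2 he,
    fun j hj _ => (truss_antitone hj).trans c2.2.2,
    c2.2.2.trans Finset.subset_union_left⟩

theorem InnerInv.truss_le_graph {ε : ℕ} {H : BipartiteGraph V} {A : Finset (Sym2 V)} {M : ℕ}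
    {x : PeelState V} (h : InnerInv G vid ε H A M x) {j : ℕ} (hj : (G.truss j).E ⊆ x.graph.E) :
    G.truss j ≤ x.graph :=
  ⟨by rw [h.peel.U_eq, h.U_eq]; exact Finset.Subset.refl _,
    by rw [h.peel.L_eq, h.L_eq]; exact Finset.Subset.refl _, hj⟩

/-- If all edges that were not assigned before have recorded support at least `M'`, then they belong
to the bitruss for `M'`. -/
theorem InnerInv.mem_truss {ε : ℕ} {H : BipartiteGraph V} {A : Finset (Sym2 V)} {M M' : ℕ}
    {x : PeelState V} (h : InnerInv G vid ε H A M x) (hMM : M ≤ M')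
    (hM' : ∀ e ∈ x.graph.E \ A, M' ≤ x.sup e) {e : Sym2 V} (he : e ∈ x.graph.E \ A) :
    e ∈ (G.truss M').E := by
  obtain ⟨heE, heA⟩ := Finset.mem_sdiff.1 he
  -- For `M' = M` the recorded support may exceed the true one, and the previous invariant is used.
  -- For `M < M'` a recorded value of at least `M'` forces true support of at least `M'`.
  rcases hMM.eq_or_lt with rfl | hlt
  · exact h.lower e heE heA
  obtain ⟨ε', -, hA⟩ := h.old
  have hK : x.graph ≤ G := le_trans' ⟨h.peel.U_eq ▸ Finset.Subset.refl _,
    h.peel.L_eq ▸ Finset.Subset.refl _, h.peel.E_sub⟩ h.le_G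
  -- Edges of `A` only guarantee support `ε'`, whence the minimum.
  have hle : x.graph ≤ G.truss (min M' ε') := by
    refine le_truss hK fun f hf => ?_
    by_cases hfA : f ∈ A
    · have h1 := h.truss_le_graph (hA ▸ h.peel.sub_graph)
      have h2 : ε' ≤ (G.truss ε').support f := le_support_truss (hA ▸ hfA)
      exact (min_le_right _ _).trans (h2.trans (support_mono h1 f))
    · have h1 := hM' f (Finset.mem_sdiff.2 ⟨hf, hfA⟩)
      rw [h.peel.sup f hf hfA] at h1
      omega
  have hmem := hle.2.2 heE
  -- If `ε' ≤ M'`, the edge would lie in `truss ε'`, that is in `A`.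
  by_cases hε : ε' ≤ M'
  · rw [min_eq_right hε, ← hA] at hmem
    exact absurd hmem heA
  · rwa [min_eq_left (by omega)] at hmem

theorem InnerInv.peelBatch (hvid : Set.InjOn vid (G.verts : Set V)) {ε : ℕ}
    {H : BipartiteGraph V} {A : Finset (Sym2 V)} {M : ℕ} {x y : PeelState V}
    (h : InnerInv G vid ε H A M x) (hb : PeelBatch ε x y) :
    (∃ M', InnerInv G vid ε H A M' y) ∧
      (y.graph.E \ y.assigned).card < (x.graph.E \ x.assigned).card := by
  have hverts : H.verts = G.verts := by rw [verts, verts, h.U_eq, h.L_eq]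
  obtain ⟨M', S, hMM, hSne, hS, hSM, hle, hpeel, hE, hassigned, hphi⟩ :=
    hb.spec (hverts ▸ hvid) h.peel
  have hSA : ∀ e ∈ S, e ∈ x.graph.E ∧ e ∉ A := fun e he => Finset.mem_sdiff.1 (hS he)
  have hSnot : ∀ e ∈ S, e ∉ x.assigned := fun e he h' =>
    (hSA e he).2 (h.peel.assigned_inter e (hSA e he).1 h')
  -- A truss with `j > M'` is still contained in the current graph, where an edge of the batch has
  -- support at most `M'`.
  have hupper : ∀ j, ε ≤ j → M' < j → ∀ e ∈ S, e ∉ (G.truss j).E := by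
    intro j hj hMj e he hej
    have h1 := support_mono (h.truss_le_graph (h.upper j hj (by omega))) e
    have h2 := le_support_truss hej
    have h3 := hSM e he
    rw [h.peel.sup e (hSA e he).1 (hSA e he).2] at h3
    omega
  refine ⟨⟨M', h.le_kMax, h.le_G, h.U_eq, h.L_eq, hpeel, h.old, ?_, ?_, ?_, ?_⟩, ?_⟩
  · intro e he
    rw [hassigned, Finset.mem_union] at he
    by_cases heS : e ∈ S
    · have hε : ε ≤ M' := by
        by_contra hε
        rw [if_neg hε] at he
        rcases he with he | he
        · exact hSnot e heS he
        · exact absurd he (Finset.notMem_empty _)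
      have hmem := h.mem_truss hMM hle (hS heS)
      exact ⟨truss_antitone hε hmem, M', by rw [hphi, if_pos ⟨heS, hε⟩],
        isBitrussNumber_of hmem fun j hj => hupper j (by omega) hj e heS⟩
    · have he' : e ∈ x.assigned := by
        rcases he with he | he
        · exact he
        · split_ifs at he
          · exact absurd he heS
          · exact absurd he (Finset.notMem_empty _)
      obtain ⟨h1, k, hk, hk'⟩ := h.correct e he'
      exact ⟨h1, k, by rw [hphi, if_neg (fun h => heS h.1)]; exact hk, hk'⟩
  · intro e he heA
    rw [hE] at he
    exact h.mem_truss hMM hle (Finset.mem_sdiff.2 ⟨(Finset.mem_sdiff.1 he).1, heA⟩)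
  · intro j hj hMj e he
    rw [hE, Finset.mem_sdiff]
    exact ⟨h.upper j hj (by omega) he, fun heS => hupper j hj hMj e heS he⟩
  · intro e he
    rw [hE, hassigned, Finset.mem_union, Finset.mem_sdiff, Finset.mem_union]
    by_cases heS : e ∈ S
    -- A batch below the threshold contains no edge of `truss ε`, so discarding it unassigned does
    -- no harm.
    · have hε : ε ≤ M' := by
        by_contra hε
        exact hupper ε le_rfl (by omega) e heS he
      rw [if_pos hε]
      exact Or.inr (Or.inr heS)
    · rcases Finset.mem_union.1 (h.cover he) with h' | h'
      · exact Or.inl ⟨h', heS⟩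
      · exact Or.inr (Or.inl h')
  · obtain ⟨e, he⟩ := hSne
    refine Finset.card_lt_card (Finset.ssubset_iff_of_subset ?_ |>.2 ⟨e, ?_, ?_⟩)
    · intro f
      rw [hE, hassigned]
      simp only [Finset.mem_sdiff, Finset.mem_union, not_or]
      tauto
    · exact Finset.mem_sdiff.2 ⟨(hSA e he).1, hSnot e he⟩
    · rw [hE]
      simp [he]

/-- Each edge of `truss ε` is either present or assigned; once nothing present is unassigned, all of
them are assigned. -/
theorem InnerInv.assigned_eq {ε : ℕ} {H : BipartiteGraph V} {A : Finset (Sym2 V)} {M : ℕ}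
    {x : PeelState V} (h : InnerInv G vid ε H A M x)
    (hx : ¬ (x.graph.E \ x.assigned).Nonempty) : x.assigned = (G.truss ε).E := by
  rw [Finset.not_nonempty_iff_eq_empty, Finset.sdiff_eq_empty_iff_subset] at hx
  exact Finset.Subset.antisymm (fun e he => (h.correct e he).1)
    (h.cover.trans (Finset.union_subset hx (Finset.Subset.refl _)))

variable (G vid) in
/-- The invariant of all configurations of a run. -/
def Config.Inv : Config V → Prop
  | .outer ε phi A => OuterInv G ε phi A
  | .inner ε x => ∃ H A M, InnerInv G vid ε H A M x
  | .returned phi => ∀ e ∈ G.E, IsCorrectAt G phi e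

variable (G) in
/-- A bound on the number of remaining steps. -/
def Config.rank : Config V → ℕ
  | .outer ε _ A =>
      -- A round has at most `|E|` batches. The extra `1` pays for entering it, and the weight `|E|
      -- + 2` per unit of threshold makes leaving it a strict decrease as well.
      if (G.E \ A).Nonempty then (ε + 1) * (G.E.card + 2) + G.E.card + 1 else 1
  | .inner ε x => (ε + 1) * (G.E.card + 2) + (x.graph.E \ x.assigned).card
  | .returned _ => 0

theorem Step.inv_and_rank_lt (hvid : Set.InjOn vid (G.verts : Set V)) (hτ : 0 < τ)
    {c c' : Config V} (h : Step G vid τ c c') (hc : c.Inv G vid) :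
    c'.Inv G vid ∧ c'.rank G < c.rank G := by
  cases h with
  | @enter ε phi A H I hne hH hI =>
    refine ⟨⟨H, A, 0, OuterInv.enter hc hH hI⟩, ?_⟩
    have h1 : (H.E \ A).card ≤ G.E.card :=
      Finset.card_le_card (Finset.sdiff_subset.trans hH.spec.1.2.2)
    simp only [Config.rank, if_pos hne]
    omega
  | @peel ε x y hne hb =>
    obtain ⟨H, A, M, hc⟩ := hc
    obtain ⟨⟨M', h1⟩, h2⟩ := hc.peelBatch hvid hb
    refine ⟨⟨H, A, M', h1⟩, ?_⟩
    simp only [Config.rank]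
    omega
  | @leave ε x hx =>
    obtain ⟨H, A, M, hc⟩ := hc
    have hA := hc.assigned_eq hx
    refine ⟨⟨(Nat.sub_le _ _).trans hc.le_kMax, ⟨ε, Nat.sub_le _ _, hA⟩,
      fun e he => (hc.correct e he).2⟩, ?_⟩
    simp only [Config.rank]
    split_ifs with hne
    -- A round with `ε = 0` assigns every edge, so an unassigned one means `ε > 0`. Then `kMax > 0`,
    -- and with `τ > 0` the step width is at least `1`.
    · have hε : 0 < ε := by
        rcases Nat.eq_zero_or_pos ε with rfl | h
        · rw [hA, truss_zero, Finset.sdiff_self] at hne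
          exact absurd hne Finset.not_nonempty_empty
        · exact h
      have hk : 0 < G.kMax := hε.trans_le hc.le_kMax
      have hceil : 0 < ⌈(G.kMax : ℝ) * τ⌉₊ :=
        Nat.ceil_pos.2 (mul_pos (by exact_mod_cast hk) hτ)
      have h1 : ε - ⌈(G.kMax : ℝ) * τ⌉₊ + 1 ≤ ε := by omega
      have h2 := Nat.mul_le_mul_right (G.E.card + 2) h1
      have h3 : (ε + 1) * (G.E.card + 2) = ε * (G.E.card + 2) + (G.E.card + 2) := by ring
      omega
    · have h3 : (ε + 1) * (G.E.card + 2) = ε * (G.E.card + 2) + (G.E.card + 2) := by ring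
      omega
  | @finish ε phi A hA =>
    rw [Finset.not_nonempty_iff_eq_empty, Finset.sdiff_eq_empty_iff_subset] at hA
    refine ⟨fun e he => hc.2.2 e (hA he), ?_⟩
    simp only [Config.rank]
    split_ifs <;> omega

theorem Config.exists_step (c : Config V) :
    (∃ c', Step G vid τ c c') ∨ ∃ phi, c = .returned phi := by
  cases c with
  | outer ε phi A =>
    left
    by_cases h : (G.E \ A).Nonempty
    · obtain ⟨I, hI⟩ := ConstructIndex.exists (keep ε (keep ε G)) vid A
      exact ⟨_, .enter h ⟨1, le_rfl, rfl⟩ hI⟩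
    · exact ⟨_, .finish h⟩
  | inner ε x =>
    left
    by_cases h : (x.graph.E \ x.assigned).Nonempty
    · obtain ⟨y, hy⟩ := PeelBatch.exists (ε := ε) h
      exact ⟨_, .peel h hy⟩
    · exact ⟨_, .leave h⟩
  | returned phi => exact Or.inr ⟨phi, rfl⟩

end Bitruss

theorem mainTheorem2 {V : Type*} [DecidableEq V] (G : Bitruss.BipartiteGraph V) (vid : V → ℕ)
    (hvid : Set.InjOn vid (G.verts : Set V)) (hlayers : ∀ u ∈ G.U, ∀ v ∈ G.L, vid v < vid u)
    (τ : ℝ) (hτ0 : 0 < τ) (hτ1 : τ ≤ 1) :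
    Bitruss.BiTPCCorrect G vid τ := by
  have hstart : (Bitruss.Config.start G).Inv G vid := Bitruss.OuterInv.start
  refine ⟨?_, fun c _ => c.exists_step, ?_⟩
  · rintro ⟨c, h0, hc⟩
    have key : ∀ n, (c n).Inv G vid ∧ (c n).rank G + n ≤ (c 0).rank G := by
      intro n
      induction n with
      | zero => exact ⟨h0 ▸ hstart, le_rfl⟩
      | succ n ih =>
        obtain ⟨h1, h2⟩ := (hc n).inv_and_rank_lt hvid hτ0 ih.1
        exact ⟨h1, by omega⟩
    have := (key ((c 0).rank G + 1)).2
    omega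
  · intro phi h
    have key : ∀ c, Relation.ReflTransGen (Bitruss.Step G vid τ) (Bitruss.Config.start G) c →
        c.Inv G vid := by
      intro c hc
      induction hc with
      | refl => exact hstart
      | tail _ hs ih => exact (hs.inv_and_rank_lt hvid hτ0 ih).1
    exact key _ h
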